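/- Let $\mathbf k$ be a field of characteristic zero; all tensor products are over $\mathbf k$. For $\mathbf k[\partial]$-modules $U,V,W$, a conformal bilinear map is a $\mathbf k$-bilinear map $f_\lambda:U\times V\to W[\lambda]$ with $f_\lambda(\partial u,v)=-\lambda f_\lambda(u,v)$ and $f_\lambda(u,\partial v)=(\lambda+\partial)f_\lambda(u,v)$. A Leibniz conformal algebra is a $\mathbf k[\partial]$-module $L$ with a conformal bilinear map $[\cdot_\lambda\cdot]:L\times L\to L[\lambda]$ such that $[a_\lambda[b_\mu c]]=[[a_\lambda b]_{\lambda+\mu}c]+[b_\mu[a_\lambda c]]$ for all $a,b,c\in L$. A Leibniz-dendriform conformal algebra (LDCA) is a $\mathbf k[\partial]$-module $Q$ with two conformal bilinear maps $\lhd_\lambda,\rhd_\lambda:Q\times Q\to Q[\lambda]$ such that for all $a,b,c\in Q$ \begin{align*} a\rhd_\lambda(b\rhd_\mu c+b\lhd_\mu c)&=(a\rhd_\lambda b)\rhd_{\lambda+\mu}c+b\lhd_\mu(a\rhd_\lambda c),\\ a\lhd_\lambda(b\rhd_\mu c)&=(a\lhd_\lambda b)\rhd_{\lambda+\mu}c+b\rhd_\mu(a\rhd_\lambda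 c+a\lhd_\lambda c),\\ a\lhd_\lambda(b\lhd_\mu c)&=(a\rhd_\lambda b+a\lhd_\lambda b)\lhd_{\lambda+\mu}c+b\lhd_\mu(a\lhd_\lambda c). \end{align*} The conformal dual of $Q$ is the space $Q^{*c}$ of $\mathbf k$-linear maps $f:Q\to\mathbf k[\lambda]$, $u\mapsto\langle f,u\rangle_\lambda$, with $\langle f,\partial u\rangle_\lambda=\lambda\langle f,u\rangle_\lambda$; it is a $\mathbf k[\partial]$-module by $\langle\partial f,u\rangle_\lambda=-\lambda\langle f,u\rangle_\lambda$. If $Q$ is a finitely generated $\mathbf k[\partial]$-module and $l_\lambda:Q\times Q\to Q[\lambda]$, $(a,v)\mapsto l(a)_\lambda v$, is a conformal bilinear map, then $l^*(a)_\lambda f\in Q^{*c}[\lambda]$ is determined by $\langle l^*(a)_\lambda f,v\rangle_\mu=-\langle f,l(a)_\lambda v\rangle_{\mu-\lambda}$. For a Leibniz conformal algebra $L$ and $r=\sum_i a_i\otimes b_i\in L\otimes L$ put $$[[r,r]]=\sum_{i,j}\Big([{a_i}_\mu a_j]\otimes b_i\otimes b_j\big|_{\mu=\partial_2}+a_i\otimes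 a_j\otimes[{b_j}_\mu b_i]\big|_{\mu=\partial_2}-a_i\otimes[{b_i}_\mu a_j]\otimes b_j\big|_{\mu=\partial_1}-a_i\otimes[{a_j}_\mu b_i]\otimes b_j\big|_{\mu=-\partial_1-\partial_2}\Big),$$ where $\partial_s$ is the action of $\partial$ on the $s$-th factor of $L\otimes L\otimes L$. Then $r$ is a solution of the classical Leibniz conformal Yang--Baxter equation (CLCYBE) in $L$ if $[[r,r]]\in(\partial_1+\partial_2+\partial_3)(L\otimes L\otimes L)$. **Theorem.** Let $(Q,\lhd_\lambda,\rhd_\lambda)$ be an LDCA that is free of finite rank over $\mathbf k[\partial]$, with $\mathbf k[\partial]$-basis $\{a^i\}_{i=1}^n$, and let $\{a_i\}_{i=1}^n$ be the dual $\mathbf k[\partial]$-basis of $Q^{*c}$, that is, $\langle a_i,a^j\rangle_\lambda=\delta_{ij}$. Put $[a_\lambda b]=a\rhd_\lambda b+a\lhd_\lambda b$, $l_\lhd(a)_\lambda b=a\lhd_\lambda b$ and $r_\rhd(a)_\lambda b=b\rhd_{-\lambda-\partial}a$. Then $Q\oplus Q^{*c}$ with the $\lambda$-bracket $$[(a+x)_\lambda(b+y)]=[a_\lambda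 b]+l_\lhd^*(a)_\lambda y-(l_\lhd^*+r_\rhd^*)(b)_{-\lambda-\partial}x\qquad(a,b\in Q,\ x,y\in Q^{*c})$$ is a Leibniz conformal algebra, denoted by $Q\ltimes_{l_\lhd^*,-l_\lhd^*-r_\rhd^*}Q^{*c}$, and $$r=\sum_{i=1}^n(a_i\otimes a^i+a^i\otimes a_i)$$ is a symmetric solution of the CLCYBE in it. -/

import Mathlib

open scoped TensorProduct Polynomial

noncomputable section


namespace LeibnizConformal

/-- The action of `∂` on a `k[∂]`-module `M`; here `k[∂]` is Mathlib's `k[X]` with `∂ = X`. -/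
def del (k : Type*) [Field k] (M : Type*) [AddCommGroup M] [Module k M] [Module k[X] M]
    [IsScalarTower k k[X] M] : Module.End k M where
  toFun m := (Polynomial.X : k[X]) • m
  map_add' := smul_add _
  map_smul' c m := by
    simp only [RingHom.id_apply, ← algebraMap_smul k[X] c m,
      ← algebraMap_smul k[X] c ((Polynomial.X : k[X]) • m), smul_smul, mul_comm]

section Polynomials

variable {k : Type*} [Field k] {M W : Type*} [AddCommGroup M] [Module k M]
  [AddCommGroup W] [Module k W]

/-- `M[λ]` is `ℕ →₀ M`, a finitely supported `m` standing for `∑ λⁿ mₙ`.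
For `m ∈ M[λ]`, a linear map `g : M → W` and an endomorphism `φ` of `W` this is
`∑ φⁿ (g mₙ)`: apply `g` to the coefficients and substitute `φ` for `λ`. -/
def subst (φ : Module.End k W) (g : M →ₗ[k] W) : (ℕ →₀ M) →ₗ[k] W :=
  Finsupp.lsum k fun n => (φ ^ n) ∘ₗ g

@[simp] lemma subst_single (φ : Module.End k W) (g : M →ₗ[k] W) (n : ℕ) (m : M) :
    subst φ g (Finsupp.single n m) = (φ ^ n) (g m) := by
  simp [subst]

lemma subst_apply (φ : Module.End k W) (g : M →ₗ[k] W) (p : ℕ →₀ M) :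
    subst φ g p = p.sum fun n m => (φ ^ n) (g m) := rfl

lemma subst_add (φ : Module.End k W) (g h : M →ₗ[k] W) :
    subst φ (g + h) = subst φ g + subst φ h := by
  ext; simp

lemma subst_smul (φ : Module.End k W) (c : k) (g : M →ₗ[k] W) :
    subst φ (c • g) = c • subst φ g := by
  ext; simp

variable (k M) in
/-- Multiplication by the variable on `M[λ]`: `∑ λⁿ mₙ ↦ ∑ λⁿ⁺¹ mₙ`. -/
def mulVar : Module.End k (ℕ →₀ M) := Finsupp.lmapDomain M k Nat.succ

@[simp] lemma mulVar_single (n : ℕ) (m : M) :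
    mulVar k M (Finsupp.single n m) = Finsupp.single (n + 1) m := by
  simp [mulVar]

lemma mulVar_apply_zero (p : ℕ →₀ M) : mulVar k M p 0 = 0 := by
  induction p using Finsupp.induction_linear with
  | zero => simp
  | add f g hf hg => simp [map_add, hf, hg]
  | single n m => simp

lemma mulVar_apply_succ (p : ℕ →₀ M) (n : ℕ) : mulVar k M p (n + 1) = p n := by
  induction p using Finsupp.induction_linear with
  | zero => simp
  | add f g hf hg => simp [map_add, hf, hg]
  | single n m => simp [Finsupp.single_apply]

variable (k M) in
/-- `M[λ, μ]`, as polynomials in `μ` with coefficients in `M[λ]`: multiplication by `λ`. -/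
def mulLam : Module.End k (ℕ →₀ ℕ →₀ M) := Finsupp.mapRange.linearMap (mulVar k M)

variable (k M) in
/-- Multiplication by `μ` on `M[λ, μ]`. -/
def mulMu : Module.End k (ℕ →₀ ℕ →₀ M) := mulVar k (ℕ →₀ M)

variable (k M) in
/-- The inclusion of `M` into `M[λ, μ]` as constants. -/
def const₂ : M →ₗ[k] (ℕ →₀ ℕ →₀ M) := Finsupp.lsingle 0 ∘ₗ Finsupp.lsingle 0

/-- Rename the variable of an element of `M[ν]`: substitute `φ` (such as `λ`, `μ` or `λ + μ`)
for `ν`, with values in `M[λ, μ]`. -/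
def evalAt (φ : Module.End k (ℕ →₀ ℕ →₀ M)) : (ℕ →₀ M) →ₗ[k] (ℕ →₀ ℕ →₀ M) :=
  subst φ (const₂ k M)

variable [Module k[X] M] [IsScalarTower k k[X] M]

variable (k M) in
/-- The substitution `λ ↦ -λ-∂` on `M[λ]`. -/
def skew : Module.End k (ℕ →₀ M) :=
  subst (-mulVar k M - del k (ℕ →₀ M)) (Finsupp.lsingle 0)

end Polynomials

/-- A conformal bilinear map from `U × V` to `W`: a `k`-bilinear map `f_λ : U × V → W[λ]`
with `f_λ(∂u, v) = -λ f_λ(u, v)` and `f_λ(u, ∂v) = (λ + ∂) f_λ(u, v)`. For `V = W` this is the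
same as a `k[∂]`-module homomorphism from `U` to `Cend(V)`. -/
structure ConformalBilin (k : Type*) [Field k] (U V W : Type*)
    [AddCommGroup U] [Module k U] [Module k[X] U] [IsScalarTower k k[X] U]
    [AddCommGroup V] [Module k V] [Module k[X] V] [IsScalarTower k k[X] V]
    [AddCommGroup W] [Module k W] [Module k[X] W] [IsScalarTower k k[X] W] where
  toLin : U →ₗ[k] V →ₗ[k] (ℕ →₀ W)
  del_left : ∀ u v, toLin (del k U u) v = -mulVar k W (toLin u v)
  del_right : ∀ u v, toLin u (del k V v) =
    mulVar k W (toLin u v) + del k (ℕ →₀ W) (toLin u v)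

section Products

variable {k : Type*} [Field k] {Q : Type*} [AddCommGroup Q] [Module k Q] [Module k[X] Q]
  [IsScalarTower k k[X] Q] {M : Type*} [AddCommGroup M] [Module k M] [Module k[X] M]
  [IsScalarTower k k[X] M]

lemma skew_mulVar (p : ℕ →₀ M) :
    skew k M (mulVar k M p) = -mulVar k M (skew k M p) - del k (ℕ →₀ M) (skew k M p) := by
  induction p using Finsupp.induction_linear with
  | zero => simp
  | add f g hf hg => simp only [map_add, hf, hg]; abel
  | single n m =>
    simp only [skew, mulVar_single, subst_single, pow_succ', Module.End.mul_apply,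
      LinearMap.sub_apply, LinearMap.neg_apply]

lemma mulVar_del (p : ℕ →₀ M) :
    mulVar k M (del k (ℕ →₀ M) p) = del k (ℕ →₀ M) (mulVar k M p) := by
  induction p using Finsupp.induction_linear with
  | zero => simp
  | add f g hf hg => simp only [map_add, hf, hg]
  | single n m => simp [del, Finsupp.smul_single]

lemma skew_del (p : ℕ →₀ M) :
    skew k M (del k (ℕ →₀ M) p) = del k (ℕ →₀ M) (skew k M p) := by
  have hc : Commute (-mulVar k M - del k (ℕ →₀ M)) (del k (ℕ →₀ M)) := by
    refine LinearMap.ext fun x => ?_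
    simp only [Module.End.mul_apply, LinearMap.sub_apply, LinearMap.neg_apply, map_sub, map_neg,
      mulVar_del (k := k) (M := M) x]
  induction p using Finsupp.induction_linear with
  | zero => simp
  | add f g hf hg => simp only [map_add, hf, hg]
  | single n m =>
    have h1 : del k (ℕ →₀ M) (Finsupp.single n m) = Finsupp.single n (del k M m) := by
      simp [del, Finsupp.smul_single]
    have h2 : (Finsupp.lsingle 0 : M →ₗ[k] (ℕ →₀ M)) (del k M m)
        = del k (ℕ →₀ M) ((Finsupp.lsingle 0 : M →ₗ[k] (ℕ →₀ M)) m) := by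
      simp [del, Finsupp.smul_single]
    rw [h1, skew, subst_single, subst_single, h2, ← Module.End.mul_apply, (hc.pow_left n).eq,
      Module.End.mul_apply]

namespace ConformalBilin

instance : Add (ConformalBilin k Q M M) where
  add f g :=
    { toLin := f.toLin + g.toLin
      del_left := fun u v => by simp [f.del_left, g.del_left]; abel
      del_right := fun u v => by simp [f.del_right, g.del_right]; abel }

instance : Neg (ConformalBilin k Q M M) where
  neg f :=
    { toLin := -f.toLin
      del_left := fun u v => by simp [f.del_left]
      del_right := fun u v => by simp [f.del_right]; abel }

/-- From a `λ`-product `b ⋆_λ a`, the right multiplication `R(a)_λ b = b ⋆_{-λ-∂} a`. -/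
def rightMul (f : ConformalBilin k Q Q Q) : ConformalBilin k Q Q Q where
  toLin := f.toLin.flip.compr₂ (skew k Q)
  del_left u v := by
    simp only [LinearMap.compr₂_apply, LinearMap.flip_apply, f.del_right, map_add, skew_mulVar,
      skew_del]
    abel
  del_right u v := by
    simp only [LinearMap.compr₂_apply, LinearMap.flip_apply, f.del_left, map_neg, skew_mulVar]
    abel

/-- `a f_λ (b g_μ c)`. -/
def nestR (f g : ConformalBilin k Q Q Q) (a b c : Q) : ℕ →₀ ℕ →₀ Q :=
  subst (mulMu k Q) (evalAt (mulLam k Q) ∘ₗ f.toLin a) (g.toLin b c)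

/-- `(a f_λ b) g_{λ+μ} c`. -/
def nestL (f g : ConformalBilin k Q Q Q) (a b c : Q) : ℕ →₀ ℕ →₀ Q :=
  subst (mulLam k Q) (evalAt (mulLam k Q + mulMu k Q) ∘ₗ g.toLin.flip c) (f.toLin a b)

/-- `b g_μ (a f_λ c)`. -/
def nestS (g f : ConformalBilin k Q Q Q) (b a c : Q) : ℕ →₀ ℕ →₀ Q :=
  subst (mulLam k Q) (evalAt (mulMu k Q) ∘ₗ g.toLin b) (f.toLin a c)

/-- A `λ`-bracket (conformal sesquilinearity is part of `ConformalBilin`) makes `Q` a Leibniz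
conformal algebra: `[a_λ [b_μ c]] = [[a_λ b]_{λ+μ} c] + [b_μ [a_λ c]]`. -/
def IsLeibniz (br : ConformalBilin k Q Q Q) : Prop :=
  ∀ a b c : Q, nestR br br a b c = nestL br br a b c + nestS br br b a c

end ConformalBilin

end Products

/-- A Leibniz-dendriform conformal algebra structure on the `k[∂]`-module `Q`. -/
structure LDCA (k : Type*) [Field k] (Q : Type*) [AddCommGroup Q] [Module k Q] [Module k[X] Q]
    [IsScalarTower k k[X] Q] where
  /-- `a ◁_λ b` -/
  lhd : ConformalBilin k Q Q Q
  /-- `a ▷_λ b` -/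
  rhd : ConformalBilin k Q Q Q
  /-- `a ▷_λ (b ▷_μ c + b ◁_μ c) = (a ▷_λ b) ▷_{λ+μ} c + b ◁_μ (a ▷_λ c)` -/
  rhd_add : ∀ a b c, rhd.nestR (rhd + lhd) a b c = rhd.nestL rhd a b c + lhd.nestS rhd b a c
  /-- `a ◁_λ (b ▷_μ c) = (a ◁_λ b) ▷_{λ+μ} c + b ▷_μ (a ▷_λ c + a ◁_λ c)` -/
  lhd_rhd : ∀ a b c, lhd.nestR rhd a b c = lhd.nestL rhd a b c + rhd.nestS (rhd + lhd) b a c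
  /-- `a ◁_λ (b ◁_μ c) = (a ▷_λ b + a ◁_λ b) ◁_{λ+μ} c + b ◁_μ (a ◁_λ c)` -/
  lhd_lhd : ∀ a b c, lhd.nestR lhd a b c = (rhd + lhd).nestL lhd a b c + lhd.nestS lhd b a c

section Dual

variable (k : Type*) [Field k] (M : Type*) [AddCommGroup M] [Module k M] [Module k[X] M]
  [IsScalarTower k k[X] M]

/-- The `k`-linear maps `f : M → k[λ]` with `f_λ(∂u) = λ f_λ(u)`, as a `k`-subspace. -/
def conformalDualSubmodule : Submodule k (M →ₗ[k] k[X]) where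
  carrier := {f | ∀ u, f (del k M u) = Polynomial.X * f u}
  add_mem' hf hg u := by simp [hf u, hg u, mul_add]
  zero_mem' u := by simp
  smul_mem' c f hf u := by simp [hf u]

/-- The conformal dual `M^{*c} = Chom(M, k)`. -/
def ConformalDual : Type _ := conformalDualSubmodule k M

instance : AddCommGroup (ConformalDual k M) :=
  inferInstanceAs (AddCommGroup (conformalDualSubmodule k M))

instance : Module k (ConformalDual k M) :=
  inferInstanceAs (Module k (conformalDualSubmodule k M))

variable {M}

/-- The pairing `⟨f, u⟩_λ = f_λ(u) ∈ k[λ]` of `f ∈ M^{*c}` with `u ∈ M`. -/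
def pair : ConformalDual k M →ₗ[k] M →ₗ[k] k[X] := (conformalDualSubmodule k M).subtype

lemma pair_del (f : ConformalDual k M) (u : M) :
    pair k f (del k M u) = Polynomial.X * pair k f u := f.2 u

variable {k} in
lemma ConformalDual.ext {f g : ConformalDual k M} (h : ∀ u, pair k f u = pair k g u) : f = g :=
  Subtype.ext (LinearMap.ext h)

/-- An element of the conformal dual from a linear map. -/
def ConformalDual.mk (f : M →ₗ[k] k[X]) (hf : ∀ u, f (del k M u) = Polynomial.X * f u) :
    ConformalDual k M := ⟨f, hf⟩

@[simp] lemma pair_mk (f : M →ₗ[k] k[X]) (hf : ∀ u, f (del k M u) = Polynomial.X * f u) (u : M) :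
    pair k (ConformalDual.mk k f hf) u = f u := rfl

variable (M)

/-- The action of `∂` on the conformal dual: `(∂ f)_λ u = -λ f_λ u`. -/
def dualDel : Module.End k (ConformalDual k M) where
  toFun f := ConformalDual.mk k (LinearMap.mulLeft k (-Polynomial.X) ∘ₗ pair k f) fun u => by
    simp only [LinearMap.comp_apply, LinearMap.mulLeft_apply, pair_del]; ring
  map_add' f g := ConformalDual.ext fun u => by simp [mul_add]
  map_smul' c f := ConformalDual.ext fun u => by simp

/-- The `k[∂]`-module structure of the conformal dual, `∂` acting by `dualDel`. -/
instance : Module k[X] (ConformalDual k M) :=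
  Module.compHom (ConformalDual k M) (Polynomial.aeval (dualDel k M)).toRingHom

variable {M} in
lemma poly_smul_def (p : k[X]) (f : ConformalDual k M) :
    p • f = Polynomial.aeval (dualDel k M) p f := rfl

instance : IsScalarTower k k[X] (ConformalDual k M) where
  smul_assoc c p f := by simp [poly_smul_def]

lemma del_conformalDual : del k (ConformalDual k M) = dualDel k M := by
  ext1 f
  simp [del, poly_smul_def]


variable {k M}

lemma pair_poly_smul (p : k[X]) (f : ConformalDual k M) (u : M) :
    pair k (p • f) u = p.comp (-Polynomial.X) * pair k f u := by
  induction p using Polynomial.induction_on' with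
  | add p q hp hq => simp [add_smul, hp, hq, add_mul]
  | monomial n c =>
    induction n generalizing f with
    | zero =>
      rw [Polynomial.monomial_zero_left, ← Polynomial.algebraMap_eq, algebraMap_smul]
      simp [Polynomial.smul_eq_C_mul]
    | succ n ih =>
      have h : (Polynomial.X : k[X]) • f = dualDel k M f := by
        rw [← del_conformalDual]; rfl
      rw [← Polynomial.monomial_mul_X, mul_smul, h, ih]
      simp [dualDel, mul_assoc, pow_succ]

lemma apply_poly_smul (f : M →ₗ[k] k[X]) (hf : ∀ u, f (del k M u) = Polynomial.X * f u)
    (p : k[X]) (u : M) : f (p • u) = p * f u := by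
  induction p using Polynomial.induction_on' with
  | add p q hp hq => simp [add_smul, hp, hq, add_mul]
  | monomial n c =>
    induction n generalizing u with
    | zero =>
      rw [Polynomial.monomial_zero_left, ← Polynomial.algebraMap_eq, algebraMap_smul]
      simp [Polynomial.smul_eq_C_mul]
    | succ n ih =>
      rw [← Polynomial.monomial_mul_X, mul_smul, ih]
      have h : (Polynomial.X : k[X]) • u = del k M u := rfl
      rw [h, hf, mul_assoc]

/-- Coordinates on the conformal dual with respect to the dual of a `k[∂]`-basis of `M`. -/
def dualCoords {ι : Type*} [Fintype ι] (b : Module.Basis ι k[X] M) :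
    ConformalDual k M ≃ₗ[k[X]] (ι → k[X]) where
  toFun f i := (pair k f (b i)).comp (-Polynomial.X)
  map_add' f g := by ext1 i; simp
  map_smul' p f := by
    ext1 i
    simp [pair_poly_smul, Polynomial.mul_comp, Polynomial.comp_assoc]
  invFun g := ConformalDual.mk k
    ((b.constr k[X] fun i => (g i).comp (-Polynomial.X)).restrictScalars k) fun u =>
      (b.constr k[X] fun i => (g i).comp (-Polynomial.X)).map_smul Polynomial.X u
  left_inv f := by
    refine ConformalDual.ext fun u => ?_
    refine Eq.trans (b.constr_apply_fintype k[X] _ u) ?_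
    conv_rhs => rw [← b.sum_equivFun u, map_sum]
    refine Finset.sum_congr rfl fun i _ => ?_
    rw [apply_poly_smul _ (pair_del k f)]
    simp [Polynomial.comp_assoc]
  right_inv g := by
    ext1 i
    refine Eq.trans (congrArg (fun p : k[X] => p.comp (-Polynomial.X))
      (b.constr_basis k[X] (fun i => (g i).comp (-Polynomial.X)) i)) ?_
    simp [Polynomial.comp_assoc]

/-- The dual `k[∂]`-basis `(a_i)` of `M^{*c}` of a `k[∂]`-basis `(a^i)` of `M`. -/
def dualBasis {ι : Type*} [Fintype ι] (b : Module.Basis ι k[X] M) :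
    Module.Basis ι k[X] (ConformalDual k M) := Module.Basis.ofEquivFun (dualCoords b)

/-- `(a_i)_λ a^j = δ_{ij}`. -/
lemma pair_dualBasis {ι : Type*} [Fintype ι] [DecidableEq ι] (b : Module.Basis ι k[X] M)
    (i j : ι) : pair k (dualBasis b i) (b j) = if i = j then 1 else 0 := by
  have h := congrFun ((dualCoords b).apply_symm_apply (Pi.single i (1 : k[X]))) j
  have h' : (pair k (dualBasis b i) (b j)).comp (-Polynomial.X) =
      (Pi.single i (1 : k[X]) : ι → k[X]) j := by
    have e : dualBasis b i = (dualCoords b).symm (Pi.single i 1) := by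
      rw [dualBasis, Module.Basis.coe_ofEquivFun]
    rw [e]
    exact h
  have h2 := congrArg (fun p : k[X] => p.comp (-Polynomial.X)) h'
  simp only [Polynomial.comp_assoc, Polynomial.neg_comp, Polynomial.X_comp, neg_neg,
    Polynomial.comp_X] at h2
  rw [h2]
  by_cases hij : i = j
  · subst hij; simp
  · rw [Pi.single_eq_of_ne' hij]; simp [hij]

/-- `⟨f, p⟩_{μ-λ} ∈ k[λ, μ]` for `f ∈ M^{*c}` and `p = ∑ λⁿ pₙ ∈ M[λ]`, that is
`∑ λⁿ f_{μ-λ}(pₙ)`. An element of `k[λ, μ]` is a polynomial in `λ = X` with coefficients in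
`k[μ]`, so that `μ = C X`. -/
def shiftPair (f : ConformalDual k M) : (ℕ →₀ M) →ₗ[k] k[X][X] :=
  subst (LinearMap.mulLeft k (Polynomial.X : k[X][X]))
    ((Polynomial.aeval (Polynomial.C Polynomial.X - Polynomial.X : k[X][X])).toLinearMap ∘ₗ
      pair k f)

lemma shiftPair_mulVar (f : ConformalDual k M) (p : ℕ →₀ M) :
    shiftPair f (mulVar k M p) = Polynomial.X * shiftPair f p := by
  induction p using Finsupp.induction_linear with
  | zero => simp
  | add f g hf hg => simp only [map_add, hf, hg, mul_add]
  | single n m =>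
    simp only [shiftPair, mulVar_single, subst_single, pow_succ', Module.End.mul_apply,
      LinearMap.mulLeft_apply]

lemma shiftPair_del (f : ConformalDual k M) (p : ℕ →₀ M) :
    shiftPair f (del k (ℕ →₀ M) p) =
      (Polynomial.C Polynomial.X - Polynomial.X) * shiftPair f p := by
  induction p using Finsupp.induction_linear with
  | zero => simp
  | add f g hf hg => simp only [map_add, hf, hg, mul_add]
  | single n m =>
    have h1 : del k (ℕ →₀ M) (Finsupp.single n m) = Finsupp.single n (del k M m) := by
      simp [del, Finsupp.smul_single]
    rw [h1]
    simp only [shiftPair, subst_single, LinearMap.comp_apply, pair_del, LinearMap.pow_mulLeft,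
      LinearMap.mulLeft_apply, AlgHom.toLinearMap_apply, map_mul, Polynomial.aeval_X]
    ring

lemma shiftPair_dualDel (f : ConformalDual k M) (p : ℕ →₀ M) :
    shiftPair (dualDel k M f) p =
      -(Polynomial.C Polynomial.X - Polynomial.X) * shiftPair f p := by
  induction p using Finsupp.induction_linear with
  | zero => simp
  | add f g hf hg => simp only [map_add, hf, hg, mul_add]
  | single n m =>
    simp only [shiftPair, subst_single, LinearMap.comp_apply, LinearMap.pow_mulLeft, dualDel,
      LinearMap.coe_mk, AddHom.coe_mk, pair_mk,
      LinearMap.mulLeft_apply, AlgHom.toLinearMap_apply, map_mul, map_neg, Polynomial.aeval_X]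
    ring

lemma shiftPair_add (f g : ConformalDual k M) : shiftPair (f + g) = shiftPair f + shiftPair g := by
  rw [shiftPair, map_add, LinearMap.comp_add, subst_add]; rfl

lemma shiftPair_smul (c : k) (f : ConformalDual k M) : shiftPair (c • f) = c • shiftPair f := by
  rw [shiftPair, map_smul, LinearMap.comp_smul, subst_smul]; rfl

variable {Q : Type*} [AddCommGroup Q] [Module k Q] [Module k[X] Q] [IsScalarTower k k[X] Q]

/-- The coefficient of `λⁿ` in `v ↦ -⟨f, l(a)_λ v⟩_{μ-λ}`, an element of `M^{*c}`. -/
def dualCoeff (l : ConformalBilin k Q M M) (a : Q) (f : ConformalDual k M) (n : ℕ) :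
    ConformalDual k M :=
  ConformalDual.mk k
    (-((Polynomial.lcoeff k[X] n).restrictScalars k ∘ₗ shiftPair f ∘ₗ l.toLin a)) fun u => by
      simp only [LinearMap.neg_apply, LinearMap.comp_apply, l.del_right, map_add,
        shiftPair_mulVar, shiftPair_del, LinearMap.restrictScalars_apply,
        Polynomial.lcoeff_apply, sub_mul, Polynomial.coeff_sub, Polynomial.coeff_C_mul]
      ring

lemma pair_dualCoeff (l : ConformalBilin k Q M M) (a : Q) (f : ConformalDual k M) (n : ℕ) (v : M) :
    pair k (dualCoeff l a f n) v = -(shiftPair f (l.toLin a v)).coeff n := rfl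

lemma dualCoeff_finite [Module.Finite k[X] M] (l : ConformalBilin k Q M M) (a : Q)
    (f : ConformalDual k M) : (Function.support (dualCoeff l a f)).Finite := by
  obtain ⟨S, hS⟩ := (Module.finite_def (R := k[X]) (M := M)).mp inferInstance
  refine Set.Finite.subset (S.biUnion fun v => (shiftPair f (l.toLin a v)).support).finite_toSet ?_
  intro n hn
  by_contra hcon
  apply hn
  simp only [Finset.coe_biUnion, Set.mem_iUnion, Finset.mem_coe, Polynomial.mem_support_iff,
    not_exists, not_not] at hcon
  refine ConformalDual.ext fun u => ?_
  have hu : u ∈ Submodule.span k[X] (S : Set M) := hS ▸ Submodule.mem_top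
  rw [map_zero, LinearMap.zero_apply]
  induction hu using Submodule.span_induction with
  | mem v hv => rw [pair_dualCoeff, hcon v hv, neg_zero]
  | zero => rw [map_zero]
  | add v w _ _ hv hw => rw [map_add, hv, hw, add_zero]
  | smul p v _ hv => rw [apply_poly_smul _ (pair_del k _), hv, mul_zero]

/-- `l*(a)_λ f ∈ M^{*c}[λ]`, for finitely generated `M`. -/
def dualApply [Module.Finite k[X] M] (l : ConformalBilin k Q M M) (a : Q)
    (f : ConformalDual k M) : ℕ →₀ ConformalDual k M :=
  Finsupp.ofSupportFinite (dualCoeff l a f) (dualCoeff_finite l a f)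

lemma dualApply_apply [Module.Finite k[X] M] (l : ConformalBilin k Q M M) (a : Q)
    (f : ConformalDual k M) (n : ℕ) (v : M) :
    pair k (dualApply l a f n) v = -(shiftPair f (l.toLin a v)).coeff n := rfl

/-- The dual `l*` of a conformal action `l` on a finitely generated `M`, given by
`⟨l*(a)_λ f, v⟩_μ = -⟨f, l(a)_λ v⟩_{μ-λ}`. -/
def ConformalBilin.dual [Module.Finite k[X] M] (l : ConformalBilin k Q M M) :
    ConformalBilin k Q (ConformalDual k M) (ConformalDual k M) where
  toLin := LinearMap.mk₂ k (dualApply l)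
    (fun a a' f => Finsupp.ext fun n => ConformalDual.ext fun v => by
      simp [dualApply_apply]; abel)
    (fun c a f => Finsupp.ext fun n => ConformalDual.ext fun v => by
      simp [dualApply_apply])
    (fun a f f' => Finsupp.ext fun n => ConformalDual.ext fun v => by
      simp [dualApply_apply, shiftPair_add]; abel)
    (fun c a f => Finsupp.ext fun n => ConformalDual.ext fun v => by
      simp [dualApply_apply, shiftPair_smul])
  del_left a f := Finsupp.ext fun n => ConformalDual.ext fun v => by
    cases n with
    | zero => simp [dualApply_apply, l.del_left, shiftPair_mulVar, mulVar_apply_zero]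
    | succ n => simp [dualApply_apply, l.del_left, shiftPair_mulVar, mulVar_apply_succ]
  del_right a f := Finsupp.ext fun n => ConformalDual.ext fun v => by
    have hd : ∀ p : ℕ →₀ ConformalDual k M, ∀ n,
        pair k (del k (ℕ →₀ ConformalDual k M) p n) v = -Polynomial.X * pair k (p n) v := by
      intro p n
      have h : del k (ℕ →₀ ConformalDual k M) p n = del k (ConformalDual k M) (p n) := rfl
      rw [h, del_conformalDual]; rfl
    cases n with
    | zero =>
      simp [hd, dualApply_apply, del_conformalDual, shiftPair_dualDel, mulVar_apply_zero, sub_mul,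
        neg_mul]
    | succ n =>
      simp [hd, dualApply_apply, del_conformalDual, shiftPair_dualDel, mulVar_apply_succ, sub_mul,
        neg_mul]
      abel

/-- `⟨l*(a)_λ f, v⟩_μ = -⟨f, l(a)_λ v⟩_{μ-λ}` in `k[λ, μ]`, compared coefficientwise in `λ`. -/
lemma pair_dual [Module.Finite k[X] M] (l : ConformalBilin k Q M M) (a : Q)
    (f : ConformalDual k M) (n : ℕ) (v : M) :
    pair k (l.dual.toLin a f n) v = -(shiftPair f (l.toLin a v)).coeff n := rfl

end Dual

section Semidirect

variable {k : Type*} [Field k] {Q : Type*} [AddCommGroup Q] [Module k Q] [Module k[X] Q]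
  [IsScalarTower k k[X] Q] {M : Type*} [AddCommGroup M] [Module k M] [Module k[X] M]
  [IsScalarTower k k[X] M]

lemma mapRange_mulVar (g : Q →ₗ[k] M) (p : ℕ →₀ Q) :
    Finsupp.mapRange.linearMap g (mulVar k Q p) =
      mulVar k M (Finsupp.mapRange.linearMap g p) := by
  induction p using Finsupp.induction_linear with
  | zero => simp
  | add f g hf hg => simp only [map_add, hf, hg]
  | single n m => simp

lemma mapRange_del (g : Q →ₗ[k] M) (hg : ∀ x, g (del k Q x) = del k M (g x)) (p : ℕ →₀ Q) :
    Finsupp.mapRange.linearMap g (del k (ℕ →₀ Q) p) =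
      del k (ℕ →₀ M) (Finsupp.mapRange.linearMap g p) :=
  Finsupp.ext fun n => hg (p n)

/-- The `λ`-bracket of the semi-direct product `Q ⋉_{l,r} M`:
`[(a + x)_λ (b + y)] = [a_λ b] + l(a)_λ y + r(b)_{-λ-∂} x` on `Q ⊕ M`. -/
def semidirect (br : ConformalBilin k Q Q Q) (l r : ConformalBilin k Q M M) :
    ConformalBilin k (Q × M) (Q × M) (Q × M) where
  toLin := LinearMap.mk₂ k
    (fun u v => Finsupp.mapRange.linearMap (LinearMap.inl k Q M) (br.toLin u.1 v.1) +
      Finsupp.mapRange.linearMap (LinearMap.inr k Q M)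
        (l.toLin u.1 v.2 + skew k M (r.toLin v.1 u.2)))
    (fun u u' v => by simp only [Prod.fst_add, Prod.snd_add, map_add, LinearMap.add_apply]; abel)
    (fun c u v => by
      simp only [Prod.smul_fst, Prod.smul_snd, map_smul, LinearMap.smul_apply, ← smul_add])
    (fun u v v' => by simp only [Prod.fst_add, Prod.snd_add, map_add, LinearMap.add_apply]; abel)
    (fun c u v => by
      simp only [Prod.smul_fst, Prod.smul_snd, map_smul, LinearMap.smul_apply, ← smul_add])
  del_left u v := by
    have h1 : (del k (Q × M) u).1 = del k Q u.1 := rfl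
    have h2 : (del k (Q × M) u).2 = del k M u.2 := rfl
    simp only [LinearMap.mk₂_apply, h1, h2, br.del_left, l.del_left, r.del_right, map_add,
      skew_mulVar, skew_del, map_neg, map_sub, mapRange_mulVar]
    abel
  del_right u v := by
    have h1 : (del k (Q × M) v).1 = del k Q v.1 := rfl
    have h2 : (del k (Q × M) v).2 = del k M v.2 := rfl
    have h3 : ∀ x, LinearMap.inl k Q M (del k Q x) = del k (Q × M) (LinearMap.inl k Q M x) :=
      fun x => by simp [del]
    have h4 : ∀ x, LinearMap.inr k Q M (del k M x) = del k (Q × M) (LinearMap.inr k Q M x) :=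
      fun x => by simp [del]
    simp only [LinearMap.mk₂_apply, h1, h2, br.del_right, l.del_right, r.del_left, map_add,
      skew_mulVar, map_neg, map_sub, mapRange_mulVar, mapRange_del _ h3, mapRange_del _ h4]
    abel

end Semidirect

section YangBaxter

variable {k : Type*} [Field k] {L : Type*} [AddCommGroup L] [Module k L] [Module k[X] L]
  [IsScalarTower k k[X] L]

variable (k L)

/-- `∂₁ = ∂ ⊗ id ⊗ id` on `L ⊗ L ⊗ L` (all tensor products over `k`). -/
def del₁ : Module.End k (L ⊗[k] (L ⊗[k] L)) := TensorProduct.map (del k L) LinearMap.id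

/-- `∂₂ = id ⊗ ∂ ⊗ id`. -/
def del₂ : Module.End k (L ⊗[k] (L ⊗[k] L)) :=
  TensorProduct.map LinearMap.id (TensorProduct.map (del k L) LinearMap.id)

/-- `∂₃ = id ⊗ id ⊗ ∂`. -/
def del₃ : Module.End k (L ⊗[k] (L ⊗[k] L)) :=
  TensorProduct.map LinearMap.id (TensorProduct.map LinearMap.id (del k L))

variable {k L}

/-- `x ↦ x ⊗ b ⊗ c`. -/
def slot₁ (b c : L) : L →ₗ[k] L ⊗[k] (L ⊗[k] L) := (TensorProduct.mk k L _).flip (b ⊗ₜ c)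

/-- `x ↦ a ⊗ x ⊗ c`. -/
def slot₂ (a c : L) : L →ₗ[k] L ⊗[k] (L ⊗[k] L) :=
  TensorProduct.mk k L _ a ∘ₗ (TensorProduct.mk k L L).flip c

/-- `x ↦ a ⊗ b ⊗ x`. -/
def slot₃ (a b : L) : L →ₗ[k] L ⊗[k] (L ⊗[k] L) :=
  TensorProduct.mk k L _ a ∘ₗ TensorProduct.mk k L L b

/-- The contribution to `[[r, r]]` of the terms `a ⊗ b` (with index `i`) and `a' ⊗ b'`
(with index `j`) of `r`:
`[a_μ a'] ⊗ b ⊗ b' |_{μ=∂₂} + a ⊗ a' ⊗ [b'_μ b] |_{μ=∂₂} - a ⊗ [b_μ a'] ⊗ b' |_{μ=∂₁}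
- a ⊗ [a'_μ b] ⊗ b' |_{μ=-∂₁-∂₂}`. -/
def ybTerm (br : ConformalBilin k L L L) (a b a' b' : L) : L ⊗[k] (L ⊗[k] L) :=
  subst (del₂ k L) (slot₁ b b') (br.toLin a a')
    + subst (del₂ k L) (slot₃ a a') (br.toLin b' b)
    - subst (del₁ k L) (slot₂ a b') (br.toLin b a')
    - subst (-del₁ k L - del₂ k L) (slot₂ a b') (br.toLin a' b)

lemma slot₁_add_left (b b' c : L) : slot₁ (k := k) (b + b') c = slot₁ b c + slot₁ b' c := by
  ext x; simp [slot₁, TensorProduct.add_tmul, TensorProduct.tmul_add]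
lemma slot₁_add_right (b c c' : L) : slot₁ (k := k) b (c + c') = slot₁ b c + slot₁ b c' := by
  ext x; simp [slot₁, TensorProduct.tmul_add]
lemma slot₁_smul_left (r : k) (b c : L) : slot₁ (k := k) (r • b) c = r • slot₁ b c := by
  rw [slot₁, ← TensorProduct.smul_tmul', map_smul]; rfl
lemma slot₁_smul_right (r : k) (b c : L) : slot₁ (k := k) b (r • c) = r • slot₁ b c := by
  ext x; simp [slot₁]
lemma slot₂_add_left (b b' c : L) : slot₂ (k := k) (b + b') c = slot₂ b c + slot₂ b' c := by
  ext x; simp [slot₂, TensorProduct.add_tmul]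
lemma slot₂_add_right (b c c' : L) : slot₂ (k := k) b (c + c') = slot₂ b c + slot₂ b c' := by
  ext x; simp [slot₂, TensorProduct.tmul_add]
lemma slot₂_smul_left (r : k) (b c : L) : slot₂ (k := k) (r • b) c = r • slot₂ b c := by
  ext x; simp [slot₂, TensorProduct.smul_tmul']
lemma slot₂_smul_right (r : k) (b c : L) : slot₂ (k := k) b (r • c) = r • slot₂ b c := by
  ext x; simp [slot₂]
lemma slot₃_add_left (b b' c : L) : slot₃ (k := k) (b + b') c = slot₃ b c + slot₃ b' c := by
  ext x; simp [slot₃, TensorProduct.add_tmul]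
lemma slot₃_add_right (b c c' : L) : slot₃ (k := k) b (c + c') = slot₃ b c + slot₃ b c' := by
  ext x; simp [slot₃, TensorProduct.add_tmul, TensorProduct.tmul_add]
lemma slot₃_smul_left (r : k) (b c : L) : slot₃ (k := k) (r • b) c = r • slot₃ b c := by
  ext x; simp [slot₃, TensorProduct.smul_tmul']
lemma slot₃_smul_right (r : k) (b c : L) : slot₃ (k := k) b (r • c) = r • slot₃ b c := by
  rw [slot₃, map_smul, LinearMap.comp_smul]; rfl

/-- The bilinear extension of `ybTerm` to `(L ⊗ L) × (L ⊗ L)`. -/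
def ybBilin (br : ConformalBilin k L L L) :
    L ⊗[k] L →ₗ[k] L ⊗[k] L →ₗ[k] L ⊗[k] (L ⊗[k] L) :=
  TensorProduct.lift <| LinearMap.mk₂ k
    (fun a b => TensorProduct.lift <| LinearMap.mk₂ k (fun a' b' => ybTerm br a b a' b')
      (fun x y z => by
        simp only [ybTerm, map_add, LinearMap.add_apply, slot₁_add_left, slot₂_add_left,
          slot₃_add_right, subst_add]; abel)
      (fun c x y => by
        simp only [ybTerm, map_smul, LinearMap.smul_apply, slot₁_smul_left, slot₂_smul_left,
          slot₃_smul_right, subst_smul, smul_add, smul_sub])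
      (fun x y z => by
        simp only [ybTerm, map_add, LinearMap.add_apply, slot₁_add_right, slot₂_add_right,
          subst_add]; abel)
      (fun c x y => by
        simp only [ybTerm, map_smul, LinearMap.smul_apply, slot₁_smul_right, slot₂_smul_right,
          subst_smul, smul_add, smul_sub]))
    (fun x y z => TensorProduct.ext' fun a' b' => by
      simp only [TensorProduct.lift.tmul, LinearMap.mk₂_apply, ybTerm, map_add,
        LinearMap.add_apply, slot₂_add_left, slot₃_add_left, subst_add]; abel)
    (fun c x y => TensorProduct.ext' fun a' b' => by
      simp only [TensorProduct.lift.tmul, LinearMap.mk₂_apply, ybTerm, map_smul,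
        LinearMap.smul_apply, slot₂_smul_left, slot₃_smul_left, subst_smul, smul_add, smul_sub])
    (fun x y z => TensorProduct.ext' fun a' b' => by
      simp only [TensorProduct.lift.tmul, LinearMap.mk₂_apply, ybTerm, map_add,
        LinearMap.add_apply, slot₁_add_left, subst_add]; abel)
    (fun c x y => TensorProduct.ext' fun a' b' => by
      simp only [TensorProduct.lift.tmul, LinearMap.mk₂_apply, ybTerm, map_smul,
        LinearMap.smul_apply, slot₁_smul_left, subst_smul, smul_add, smul_sub])

lemma ybBilin_tmul (br : ConformalBilin k L L L) (a b a' b' : L) :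
    ybBilin br (a ⊗ₜ b) (a' ⊗ₜ b') = ybTerm br a b a' b' := rfl

/-- `r ∈ L ⊗ L` solves the classical Leibniz conformal Yang-Baxter equation for the `λ`-bracket
`br`: `[[r, r]] ≡ 0` modulo the image of `∂₁ + ∂₂ + ∂₃` on `L ⊗ L ⊗ L`. -/
def IsCLCYBESolution (br : ConformalBilin k L L L) (r : L ⊗[k] L) : Prop :=
  ybBilin br r r ∈ LinearMap.range (del₁ k L + del₂ k L + del₃ k L)

end YangBaxter

section Construction

variable {k : Type*} [Field k] {Q : Type*} [AddCommGroup Q] [Module k Q] [Module k[X] Q]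
  [IsScalarTower k k[X] Q]

/-- The `λ`-bracket `[a_λ b] = a ▷_λ b + a ◁_λ b` of an LDCA. -/
def LDCA.bracket (A : LDCA k Q) : ConformalBilin k Q Q Q := A.rhd + A.lhd

/-- The `λ`-bracket of `Q ⋉ Q^{*c}` for the representation `(Q^{*c}, l*, -l* - r*)`, where
`l(a)_λ b = a ◁_λ b` and `r(a)_λ b = b ▷_{-λ-∂} a`. -/
def LDCA.semidirectBracket [Module.Finite k[X] Q] (A : LDCA k Q) :
    ConformalBilin k (Q × ConformalDual k Q) (Q × ConformalDual k Q) (Q × ConformalDual k Q) :=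
  semidirect A.bracket A.lhd.dual (-A.lhd.dual + -A.rhd.rightMul.dual)

/-- `r = ∑ᵢ (a_i ⊗ a^i + a^i ⊗ a_i)` for a `k[∂]`-basis `(a^i)` of `Q` and the dual `k[∂]`-basis
`(a_i)` of `Q^{*c}`. -/
def canonicalTensor {ι : Type*} [Fintype ι] (b : Module.Basis ι k[X] Q) :
    (Q × ConformalDual k Q) ⊗[k] (Q × ConformalDual k Q) :=
  ∑ i, (((0, dualBasis b i) : Q × ConformalDual k Q) ⊗ₜ[k] ((b i, 0) : Q × ConformalDual k Q)
    + ((b i, 0) : Q × ConformalDual k Q) ⊗ₜ[k] ((0, dualBasis b i) : Q × ConformalDual k Q))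

end Construction

end LeibnizConformal

end

/-!
An identity between `λ`-products is an identity between the values in a commutative `k`-algebra `R`
obtained by specialising each formal variable to an element of `R` and applying functionals; no
information is lost when `R` is a polynomial ring and the values are generic. A functional that
turns `∂` into multiplication by a scalar turns conformal sesquilinearity into a substitution
rule, and duals of actions become transposes of bilinear forms.

On `Q ⊕ Q^{*c}` the Leibniz identity then reduces to the LDCA identities. The coordinates in the
basis `(a^i), (a_i)` are given by the symmetric pairing of `Q ⊕ Q^{*c}` with the swapped basis
`(a_i), (a^i)`, so the coordinates of `[[r, r]]` are values of the invariance relation between this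
pairing and the bracket, which holds for arbitrary conformal products `◁` and `▷`.
-/

noncomputable section

namespace LeibnizConformal

section Evaluation

variable {k : Type*} [Field k] {M N W : Type*} [AddCommGroup M] [Module k M]
  [AddCommGroup N] [Module k N] [AddCommGroup W] [Module k W] {R : Type*} [CommRing R]
  [Algebra k R]

/-- The value `∑ sⁿ h(pₙ)` at `λ = s` of `p ∈ M[λ]` under a functional `h : M → R`. Allowing
values in an arbitrary commutative `k`-algebra `R` makes it possible to choose `s` generic. -/
def evalMap (s : R) : (M →ₗ[k] R) →ₗ[k] (ℕ →₀ M) →ₗ[k] R where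
  toFun := subst (LinearMap.mulLeft k s)
  map_add' := subst_add _
  map_smul' := subst_smul _

@[simp] lemma evalMap_single (s : R) (h : M →ₗ[k] R) (n : ℕ) (m : M) :
    evalMap s h (Finsupp.single n m) = s ^ n * h m := by
  simp [evalMap, LinearMap.pow_mulLeft]

lemma map_subst_eq_evalMap {φ : Module.End k W} {g : W →ₗ[k] R} {s : R}
    (hg : ∀ w, g (φ w) = s * g w) (f : M →ₗ[k] W) (p : ℕ →₀ M) :
    g (subst φ f p) = evalMap s (g ∘ₗ f) p := by
  have hpow (n : ℕ) (w : W) : g ((φ ^ n) w) = s ^ n * g w := by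
    induction n with
    | zero => simp
    | succ n ih => rw [pow_succ', Module.End.mul_apply, hg, ih, pow_succ', mul_assoc]
  refine LinearMap.congr_fun (f := g ∘ₗ subst φ f) (Finsupp.lhom_ext fun n m => ?_) p
  simp [hpow]

lemma algHom_evalMap {S : Type*} [CommRing S] [Algebra k S] (g : R →ₐ[k] S) (s : R)
    (h : M →ₗ[k] R) (p : ℕ →₀ M) :
    g (evalMap s h p) = evalMap (g s) (g.toLinearMap ∘ₗ h) p :=
  map_subst_eq_evalMap (g := g.toLinearMap) (map_mul g s) h p

lemma evalMap_mulLeft_comp (s c : R) (h : M →ₗ[k] R) (p : ℕ →₀ M) :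
    evalMap s (LinearMap.mulLeft k c ∘ₗ h) p = c * evalMap s h p :=
  (map_subst_eq_evalMap (g := LinearMap.mulLeft k c) (mul_left_comm c s) h p).symm

lemma evalMap_mulVar (s : R) (h : M →ₗ[k] R) (p : ℕ →₀ M) :
    evalMap s h (mulVar k M p) = s * evalMap s h p := by
  refine LinearMap.congr_fun (f := evalMap s h ∘ₗ mulVar k M) (g := LinearMap.mulLeft k s ∘ₗ
    evalMap s h) (Finsupp.lhom_ext fun n m => ?_) p
  simp [pow_succ', mul_assoc]

lemma evalMap_mapRange (s : R) (h : W →ₗ[k] R) (g : M →ₗ[k] W) (p : ℕ →₀ M) :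
    evalMap s h (Finsupp.mapRange.linearMap g p) = evalMap s (h ∘ₗ g) p := by
  refine LinearMap.congr_fun (f := evalMap s h ∘ₗ Finsupp.mapRange.linearMap g)
    (Finsupp.lhom_ext fun n m => ?_) p
  simp

lemma evalMap_flip_comm (B : M →ₗ[k] N →ₗ[k] R) (s t : R) (p : ℕ →₀ M) (q : ℕ →₀ N) :
    evalMap s ((evalMap t ∘ₗ B).flip q) p = evalMap t ((evalMap s ∘ₗ B.flip).flip p) q := by
  refine LinearMap.congr_fun (g := (evalMap t ∘ₗ (evalMap s ∘ₗ B.flip).flip).flip q)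
    (Finsupp.lhom_ext fun n x => ?_) p
  refine LinearMap.congr_fun (f := (LinearMap.mulLeft k (s ^ n)) ∘ₗ evalMap t (B x))
    (g := evalMap t ((evalMap s ∘ₗ B.flip).flip (Finsupp.single n x)))
    (Finsupp.lhom_ext fun m y => ?_) q |> Eq.trans (by simp)
  simp [mul_left_comm]

/-- `M[λ] → R[λ]` for a functional `M → R`, realised as evaluation at the generic point. -/
def genericEval (h : M →ₗ[k] R) : (ℕ →₀ M) →ₗ[k] R[X] :=
  evalMap Polynomial.X ((Polynomial.CAlgHom (R := k)).toLinearMap ∘ₗ h)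

lemma coeff_genericEval (h : M →ₗ[k] R) (p : ℕ →₀ M) (n : ℕ) :
    (genericEval h p).coeff n = h (p n) := by
  refine LinearMap.congr_fun (f := (Polynomial.lcoeff R n).restrictScalars k ∘ₗ genericEval h)
    (g := h ∘ₗ Finsupp.lapply n) (Finsupp.lhom_ext fun m x => ?_) p
  simp [genericEval, Polynomial.X_pow_mul_C, Polynomial.coeff_X_pow, Finsupp.single_apply,
    apply_ite h, eq_comm (a := n)]

lemma eq_zero_of_genericEval {ι : Type*} {F : ι → M →ₗ[k] R}
    (hF : ∀ m, (∀ i, F i m = 0) → m = 0) (p : ℕ →₀ M) (hp : ∀ i, genericEval (F i) p = 0) :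
    p = 0 :=
  Finsupp.ext fun n => hF _ fun i => by rw [← coeff_genericEval, hp, Polynomial.coeff_zero]

lemma genericEval_genericEval (h : M →ₗ[k] R) :
    genericEval (genericEval h) = evalMap Polynomial.X (evalMap (Polynomial.C Polynomial.X)
      ((Polynomial.CAlgHom (R := k) (A := R[X])).toLinearMap ∘ₗ
        (Polynomial.CAlgHom (R := k) (A := R)).toLinearMap ∘ₗ h)) :=
  congrArg (evalMap Polynomial.X) (LinearMap.ext (algHom_evalMap Polynomial.CAlgHom _ _))

lemma evalMap_evalMap_mulLam (s t : R) (h : M →ₗ[k] R) (p : ℕ →₀ ℕ →₀ M) :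
    evalMap t (evalMap s h) (mulLam k M p) = s * evalMap t (evalMap s h) p := by
  rw [mulLam, evalMap_mapRange, ← evalMap_mulLeft_comp]
  exact congrArg (evalMap t · p) (LinearMap.ext (evalMap_mulVar s h))

lemma evalMap_evalMap_evalAt {s t r : R} {h : M →ₗ[k] R} {φ : Module.End k (ℕ →₀ ℕ →₀ M)}
    (hφ : ∀ p, evalMap t (evalMap s h) (φ p) = r * evalMap t (evalMap s h) p) (p : ℕ →₀ M) :
    evalMap t (evalMap s h) (evalAt φ p) = evalMap r h p := by
  rw [evalAt, map_subst_eq_evalMap hφ]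
  exact congrArg (evalMap r · p) (LinearMap.ext fun m => by simp [const₂])

variable [Module k[X] M] [IsScalarTower k k[X] M]

/-- `h : M → R` has weight `u` if `∂` acts through it as multiplication by `u`, as it does
for `h = ⟨f, ·⟩_u` with `f` in the conformal dual of `M`. -/
def HasWeight (h : M →ₗ[k] R) (u : R) : Prop := ∀ m, h (del k M m) = u * h m

lemma HasWeight.evalMap_del {h : M →ₗ[k] R} {u : R} (hu : HasWeight h u) (s : R)
    (p : ℕ →₀ M) : evalMap s h (del k (ℕ →₀ M) p) = u * evalMap s h p := by
  rw [← evalMap_mulLeft_comp]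
  refine (evalMap_mapRange s h (del k M) p).trans ?_
  exact congrArg (evalMap s · p) (LinearMap.ext hu)

lemma HasWeight.evalMap_skew {h : M →ₗ[k] R} {u : R} (hu : HasWeight h u) (s : R)
    (p : ℕ →₀ M) : evalMap s h (skew k M p) = evalMap (-s - u) h p := by
  have hs (q : ℕ →₀ M) : evalMap s h ((-mulVar k M - del k (ℕ →₀ M)) q) =
      (-s - u) * evalMap s h q := by
    rw [LinearMap.sub_apply, LinearMap.neg_apply, map_sub, map_neg, evalMap_mulVar,
      hu.evalMap_del]
    ring
  rw [skew, map_subst_eq_evalMap hs]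
  exact congrArg (evalMap (-s - u) · p) (LinearMap.ext fun m => by simp)

end Evaluation

section Products

variable {k : Type*} [Field k] {R : Type*} [CommRing R] [Algebra k R]
  {U V W : Type*} [AddCommGroup U] [Module k U] [Module k[X] U] [IsScalarTower k k[X] U]
  [AddCommGroup V] [Module k V] [Module k[X] V] [IsScalarTower k k[X] V]
  [AddCommGroup W] [Module k W] [Module k[X] W] [IsScalarTower k k[X] W]
  {Q : Type*} [AddCommGroup Q] [Module k Q] [Module k[X] Q] [IsScalarTower k k[X] Q]

namespace ConformalBilin

/-- The scalar bilinear form `(u, v) ↦ h(f_s(u, v))` obtained from a conformal bilinear map `f`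
by specialising `λ` to `s` and applying a functional `h`. -/
def eval (f : ConformalBilin k U V W) (s : R) : (W →ₗ[k] R) →ₗ[k] U →ₗ[k] V →ₗ[k] R where
  toFun h := f.toLin.compr₂ (evalMap s h)
  map_add' h₁ h₂ := by ext; simp
  map_smul' c h := by ext; simp

lemma eval_apply (f : ConformalBilin k U V W) (s : R) (h : W →ₗ[k] R) (u : U) (v : V) :
    f.eval s h u v = evalMap s h (f.toLin u v) := rfl

lemma add_eval (f g : ConformalBilin k Q V V) (s : R) :
    (f + g).eval s = f.eval s + g.eval s := by
  ext; exact map_add (evalMap s _) _ _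

lemma neg_eval (f : ConformalBilin k Q V V) (s : R) (h : V →ₗ[k] R) :
    (-f).eval s h = -f.eval s h := by
  ext; exact map_neg (evalMap s h) _

lemma rightMul_eval (f : ConformalBilin k Q Q Q) (s : R) {h : Q →ₗ[k] R} {w : R}
    (hw : HasWeight h w) (a b : Q) : f.rightMul.eval s h a b = f.eval (-s - w) h b a :=
  hw.evalMap_skew s _

lemma evalMap_nestR (f g : ConformalBilin k Q Q Q) (s t : R) (h : Q →ₗ[k] R) (a b c : Q) :
    evalMap t (evalMap s h) (f.nestR g a b c) = g.eval t (f.eval s h a) b c := by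
  rw [nestR, mulMu, map_subst_eq_evalMap (evalMap_mulVar t (evalMap s h))]
  exact congrArg (evalMap t · (g.toLin b c)) (LinearMap.ext fun x =>
    evalMap_evalMap_evalAt (evalMap_evalMap_mulLam s t h) (f.toLin a x))

lemma evalMap_nestL (f g : ConformalBilin k Q Q Q) (s t : R) (h : Q →ₗ[k] R) (a b c : Q) :
    evalMap t (evalMap s h) (f.nestL g a b c) = f.eval s ((g.eval (s + t) h).flip c) a b := by
  have hst (p : ℕ →₀ ℕ →₀ Q) : evalMap t (evalMap s h) ((mulLam k Q + mulMu k Q) p) =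
      (s + t) * evalMap t (evalMap s h) p := by
    rw [LinearMap.add_apply, map_add, evalMap_evalMap_mulLam, mulMu, evalMap_mulVar, add_mul]
  rw [nestL, map_subst_eq_evalMap (evalMap_evalMap_mulLam s t h)]
  exact congrArg (evalMap s · (f.toLin a b)) (LinearMap.ext fun x =>
    evalMap_evalMap_evalAt hst (g.toLin x c))

lemma evalMap_nestS (g f : ConformalBilin k Q Q Q) (s t : R) (h : Q →ₗ[k] R) (b a c : Q) :
    evalMap t (evalMap s h) (g.nestS f b a c) = f.eval s (g.eval t h b) a c := by
  rw [nestS, map_subst_eq_evalMap (evalMap_evalMap_mulLam s t h)]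
  exact congrArg (evalMap s · (f.toLin a c)) (LinearMap.ext fun x =>
    evalMap_evalMap_evalAt (evalMap_mulVar t (evalMap s h)) (g.toLin b x))

lemma isLeibniz_of_eval {ι : Type*} {F : ι → Q →ₗ[k] R} (hF : ∀ q, (∀ i, F i q = 0) → q = 0)
    (br : ConformalBilin k Q Q Q)
    (hbr : ∀ (i : ι) (h : Q →ₗ[k] R[X][X]), (∀ q, h q = Polynomial.C (Polynomial.C (F i q))) →
      ∀ (s t : R[X][X]) (a b c : Q), br.eval t (br.eval s h a) b c =
        br.eval s ((br.eval (s + t) h).flip c) a b + br.eval s (br.eval t h b) a c) :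
    br.IsLeibniz := fun a b c => by
  rw [← sub_eq_zero]
  refine eq_zero_of_genericEval (F := fun i => genericEval (F i))
    (fun p hp => eq_zero_of_genericEval hF p hp) _ fun i => ?_
  rw [genericEval_genericEval, map_sub, map_add, evalMap_nestR, evalMap_nestL, evalMap_nestS,
    sub_eq_zero]
  exact hbr i _ (fun _ => rfl) _ _ a b c

end ConformalBilin

namespace LDCA

open ConformalBilin

variable (A : LDCA k Q) (s t : R) (h : Q →ₗ[k] R) (a b c : Q)

lemma eval_rhd_bracket : A.bracket.eval t (A.rhd.eval s h a) b c =
    A.rhd.eval s ((A.rhd.eval (s + t) h).flip c) a b + A.rhd.eval s (A.lhd.eval t h b) a c := by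
  rw [bracket, ← evalMap_nestR, ← evalMap_nestL, ← evalMap_nestS, ← map_add, A.rhd_add]

lemma eval_lhd_rhd : A.rhd.eval t (A.lhd.eval s h a) b c =
    A.lhd.eval s ((A.rhd.eval (s + t) h).flip c) a b +
      A.bracket.eval s (A.rhd.eval t h b) a c := by
  rw [bracket, ← evalMap_nestR, ← evalMap_nestL, ← evalMap_nestS, ← map_add, A.lhd_rhd]

lemma eval_lhd_lhd : A.lhd.eval t (A.lhd.eval s h a) b c =
    A.bracket.eval s ((A.lhd.eval (s + t) h).flip c) a b +
      A.lhd.eval s (A.lhd.eval t h b) a c := by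
  rw [bracket, ← evalMap_nestR, ← evalMap_nestL, ← evalMap_nestS, ← map_add, A.lhd_lhd]

lemma eval_rhd_rhd_add_eval_lhd_rhd :
    A.rhd.eval s ((A.rhd.eval (s + t) h).flip c) a b +
      A.lhd.eval t ((A.rhd.eval (s + t) h).flip c) b a = 0 := by
  have h₁ := A.eval_rhd_bracket s t h a b c
  have h₂ := A.eval_lhd_rhd t s h b a c
  rw [add_comm t s] at h₂
  linear_combination -h₁ - h₂

lemma eval_bracket_bracket : A.bracket.eval t (A.bracket.eval s h a) b c =
    A.bracket.eval s ((A.bracket.eval (s + t) h).flip c) a b +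
      A.bracket.eval s (A.bracket.eval t h b) a c := by
  have h₁ := A.eval_rhd_bracket s t h a b c
  have h₂ := A.eval_lhd_rhd s t h a b c
  have h₃ := A.eval_lhd_lhd s t h a b c
  have hflip : (A.bracket.eval (s + t) h).flip c =
      (A.rhd.eval (s + t) h).flip c + (A.lhd.eval (s + t) h).flip c := by
    rw [bracket, add_eval]; rfl
  rw [hflip]
  simp only [bracket, add_eval, map_add, LinearMap.add_apply] at h₁ h₂ h₃ ⊢
  linear_combination h₁ + h₂ + h₃

end LDCA

end Products

section Pairing

variable {k : Type*} [Field k] {R : Type*} [CommRing R] [Algebra k R]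
  {Q : Type*} [AddCommGroup Q] [Module k Q] [Module k[X] Q] [IsScalarTower k k[X] Q]
  {M : Type*} [AddCommGroup M] [Module k M] [Module k[X] M] [IsScalarTower k k[X] M]

/-- The pairing `⟨f, v⟩_u` of `f` in the conformal dual of `M` with `v ∈ M`, specialised to
`λ = u ∈ R`. -/
def pairAt (u : R) : ConformalDual k M →ₗ[k] M →ₗ[k] R :=
  (pair k).compr₂ (Polynomial.aeval u).toLinearMap

lemma pairAt_apply (u : R) (f : ConformalDual k M) (v : M) :
    pairAt u f v = Polynomial.aeval u (pair k f v) := rfl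

lemma hasWeight_pairAt (u : R) (f : ConformalDual k M) : HasWeight (pairAt u f) u :=
  fun v => by simp [pairAt_apply, pair_del]

lemma hasWeight_pairAt_flip (u : R) (v : M) :
    HasWeight ((pairAt (k := k) u).flip v) (-u) := fun f => by
  simp [pairAt_apply, del_conformalDual, dualDel]

lemma pairAt_C_C_X (f : ConformalDual k M) (v : M) :
    pairAt (Polynomial.C (Polynomial.C Polynomial.X) : k[X][X][X]) f v =
      Polynomial.C (Polynomial.C (pair k f v)) := by
  have h : Polynomial.aeval (Polynomial.C (Polynomial.C Polynomial.X) : k[X][X][X]) =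
      Polynomial.CAlgHom.comp (Polynomial.CAlgHom (R := k) (A := k[X])) :=
    Polynomial.algHom_ext (by simp)
  exact congrArg (· (pair k f v)) h

lemma genericEval_dual [Module.Finite k[X] M] (l : ConformalBilin k Q M M) (a : Q)
    (f : ConformalDual k M) (v : M) :
    genericEval ((pair k).flip v) (l.dual.toLin a f) = -shiftPair f (l.toLin a v) :=
  Polynomial.ext fun n => by
    rw [coeff_genericEval, LinearMap.flip_apply, pair_dual, Polynomial.coeff_neg]

lemma aevalAeval_shiftPair (s u : R) (f : ConformalDual k M) (p : ℕ →₀ M) :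
    Polynomial.aevalAeval u s (shiftPair f p) = evalMap s (pairAt (u - s) f) p := by
  refine (algHom_evalMap (Polynomial.aevalAeval u s) _ _ p).trans ?_
  rw [Polynomial.aevalAeval_Y]
  refine congrArg (evalMap s · p) (LinearMap.ext fun w => ?_)
  simp only [LinearMap.comp_apply, AlgHom.toLinearMap_apply, pairAt_apply]
  rw [← Polynomial.aeval_algHom_apply, map_sub, Polynomial.aevalAeval_X, Polynomial.aevalAeval_Y]

lemma ConformalBilin.dual_eval [Module.Finite k[X] M] (l : ConformalBilin k Q M M) (s u : R)
    (a : Q) (f : ConformalDual k M) (v : M) :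
    l.dual.eval s ((pairAt u).flip v) a f = -l.eval s (pairAt (u - s) f) a v := by
  have hθ : Polynomial.aevalAeval u s (genericEval ((pair k).flip v) (l.dual.toLin a f)) =
      l.dual.eval s ((pairAt u).flip v) a f := by
    rw [genericEval, algHom_evalMap, Polynomial.aevalAeval_Y]
    exact congrArg (evalMap s · _) (LinearMap.ext fun g => Polynomial.aevalAeval_C u s _)
  rw [← hθ, genericEval_dual, map_neg, aevalAeval_shiftPair, eval_apply]

/-- The pairing `⟨f, p_s⟩_u` of `f` in the conformal dual of `M` with the value at `λ = s` of
`p ∈ M[λ]`. -/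
def polyPairAt (u s : R) : (ℕ →₀ M) →ₗ[k] ConformalDual k M →ₗ[k] R :=
  (evalMap s ∘ₗ pairAt u).flip

lemma polyPairAt_apply (u s : R) (p : ℕ →₀ M) (f : ConformalDual k M) :
    polyPairAt u s p f = evalMap s (pairAt u f) p := rfl

lemma hasWeight_polyPairAt (u s : R) (p : ℕ →₀ M) : HasWeight (polyPairAt (k := k) u s p) (-u) :=
  fun f => by
    have hf : pairAt u (del k _ f) = LinearMap.mulLeft k (-u) ∘ₗ pairAt u f :=
      LinearMap.ext fun v => hasWeight_pairAt_flip u v f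
    rw [polyPairAt_apply, hf, evalMap_mulLeft_comp, polyPairAt_apply]

lemma ConformalBilin.dual_eval_polyPairAt [Module.Finite k[X] M] (l : ConformalBilin k Q M M)
    (s t u : R) (a : Q) (f : ConformalDual k M) (p : ℕ →₀ M) :
    l.dual.eval t (polyPairAt u s p) a f = -evalMap s (l.eval t (pairAt (u - t) f) a) p :=
  calc l.dual.eval t (polyPairAt u s p) a f
    _ = evalMap s ((evalMap t ∘ₗ (pairAt u).flip).flip (l.dual.toLin a f)) p :=
      evalMap_flip_comm _ _ _ _ _
    _ = evalMap s (-l.eval t (pairAt (u - t) f) a) p :=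
      congrArg (evalMap s · p) (LinearMap.ext fun v => l.dual_eval t u a f v)
    _ = _ := by rw [map_neg, LinearMap.neg_apply]

end Pairing

section Semidirect

variable {k : Type*} [Field k] {R : Type*} [CommRing R] [Algebra k R]
  {Q : Type*} [AddCommGroup Q] [Module k Q] [Module k[X] Q] [IsScalarTower k k[X] Q]
  {M : Type*} [AddCommGroup M] [Module k M] [Module k[X] M] [IsScalarTower k k[X] M]

lemma semidirect_eval_fst (br : ConformalBilin k Q Q Q) (l r : ConformalBilin k Q M M) (s : R)
    (g : Q →ₗ[k] R) (p q : Q × M) :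
    (semidirect br l r).eval s (g ∘ₗ LinearMap.fst k Q M) p q = br.eval s g p.1 q.1 := by
  simp only [ConformalBilin.eval_apply, semidirect, LinearMap.mk₂_apply, map_add,
    evalMap_mapRange, LinearMap.comp_assoc, LinearMap.fst_comp_inl, LinearMap.fst_comp_inr,
    LinearMap.comp_id, LinearMap.comp_zero, map_zero, LinearMap.zero_apply, add_zero]

lemma semidirect_eval_snd (br : ConformalBilin k Q Q Q) (l r : ConformalBilin k Q M M) (s : R)
    {h : M →ₗ[k] R} {w : R} (hw : HasWeight h w) (p q : Q × M) :
    (semidirect br l r).eval s (h ∘ₗ LinearMap.snd k Q M) p q =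
      l.eval s h p.1 q.2 + r.eval (-s - w) h q.1 p.2 := by
  simp only [ConformalBilin.eval_apply, semidirect, LinearMap.mk₂_apply, map_add,
    evalMap_mapRange, LinearMap.comp_assoc, LinearMap.snd_comp_inl, LinearMap.snd_comp_inr,
    LinearMap.comp_id, LinearMap.comp_zero, map_zero, LinearMap.zero_apply, zero_add,
    hw.evalMap_skew]

variable [Module.Finite k[X] Q]

/-- The `λ`-product on `Q ⊕ Q^{*c}` of the theorem, for arbitrary products `◁` and `▷` on `Q`. -/
def dualSemidirect (lhd rhd : ConformalBilin k Q Q Q) :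
    ConformalBilin k (Q × ConformalDual k Q) (Q × ConformalDual k Q) (Q × ConformalDual k Q) :=
  semidirect (rhd + lhd) lhd.dual (-lhd.dual + -rhd.rightMul.dual)

variable (lhd rhd : ConformalBilin k Q Q Q) (s t u : R) (p q : Q × ConformalDual k Q)

lemma dualSemidirect_eval_fst (g : Q →ₗ[k] R) :
    (dualSemidirect lhd rhd).eval s (g ∘ₗ LinearMap.fst k Q _) p q =
      (rhd + lhd).eval s g p.1 q.1 :=
  semidirect_eval_fst _ _ _ s g p q

lemma dualSemidirect_eval_polyPairAt (ω : ℕ →₀ Q) :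
    (dualSemidirect lhd rhd).eval t (polyPairAt u s ω ∘ₗ LinearMap.snd k Q _) p q =
      -evalMap s (lhd.eval t (pairAt (u - t) q.2) p.1) ω +
        evalMap s (lhd.eval (u - t) (pairAt t p.2) q.1) ω +
        evalMap s ((rhd.eval (-u) (pairAt t p.2)).flip q.1) ω := by
  have hrhd : rhd.rightMul.eval (u - t) (pairAt t p.2) q.1 =
      (rhd.eval (-u) (pairAt t p.2)).flip q.1 := LinearMap.ext fun v => by
    rw [rhd.rightMul_eval _ (hasWeight_pairAt t p.2), LinearMap.flip_apply,
      show -(u - t) - t = -u by ring]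
  rw [dualSemidirect, semidirect_eval_snd _ _ _ _ (hasWeight_polyPairAt u s ω),
    show -t - -u = u - t by ring, ConformalBilin.add_eval]
  simp only [ConformalBilin.neg_eval, LinearMap.add_apply, LinearMap.neg_apply,
    ConformalBilin.dual_eval_polyPairAt, sub_sub_cancel, hrhd, neg_neg, add_assoc]

lemma dualSemidirect_eval_pairAt (v : Q) :
    (dualSemidirect lhd rhd).eval s ((pairAt u).flip v ∘ₗ LinearMap.snd k Q _) p q =
      -lhd.eval s (pairAt (u - s) q.2) p.1 v + lhd.eval (u - s) (pairAt s p.2) q.1 v +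
        rhd.eval (-u) (pairAt s p.2) v q.1 := by
  have hv : (pairAt u).flip v = polyPairAt (k := k) u 0 (Finsupp.single 0 v) :=
    LinearMap.ext fun f => by simp [polyPairAt_apply]
  simp only [hv, dualSemidirect_eval_polyPairAt, evalMap_single, pow_zero, one_mul,
    LinearMap.flip_apply]

lemma dualSemidirect_eval_pairAt_left (v : Q) :
    (dualSemidirect lhd rhd).eval s ((pairAt u).flip v ∘ₗ LinearMap.snd k Q _) p =
      ((lhd.eval (u - s) (pairAt s p.2)).flip v + rhd.eval (-u) (pairAt s p.2) v) ∘ₗ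
          LinearMap.fst k Q _ -
        polyPairAt (u - s) s (lhd.toLin p.1 v) ∘ₗ LinearMap.snd k Q _ :=
  LinearMap.ext fun q => by
    rw [dualSemidirect_eval_pairAt, add_assoc, neg_add_eq_sub]; rfl

lemma dualSemidirect_eval_pairAt_right (v : Q) :
    ((dualSemidirect lhd rhd).eval s ((pairAt u).flip v ∘ₗ LinearMap.snd k Q _)).flip q =
      (polyPairAt s (u - s) (lhd.toLin q.1 v) + polyPairAt s (-u) (rhd.toLin v q.1)) ∘ₗ
          LinearMap.snd k Q _ -
        (lhd.eval s (pairAt (u - s) q.2)).flip v ∘ₗ LinearMap.fst k Q _ :=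
  LinearMap.ext fun p => by
    rw [LinearMap.flip_apply, dualSemidirect_eval_pairAt, add_assoc, neg_add_eq_sub]; rfl

end Semidirect

section Leibniz

open ConformalBilin

variable {k : Type*} [Field k] {R : Type*} [CommRing R] [Algebra k R]
  {Q : Type*} [AddCommGroup Q] [Module k Q] [Module k[X] Q] [IsScalarTower k k[X] Q]
  [Module.Finite k[X] Q] (A : LDCA k Q)

namespace LDCA

lemma semidirectBracket_eq : A.semidirectBracket = dualSemidirect A.lhd A.rhd := rfl

lemma semidirectBracket_eval_fst (s : R) (g : Q →ₗ[k] R) (p q : Q × ConformalDual k Q) :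
    A.semidirectBracket.eval s (g ∘ₗ LinearMap.fst k Q _) p q = A.bracket.eval s g p.1 q.1 :=
  dualSemidirect_eval_fst A.lhd A.rhd s p q g

lemma semidirectBracket_leibniz_eval_fst (s t : R) (g : Q →ₗ[k] R)
    (p q r : Q × ConformalDual k Q) :
    A.semidirectBracket.eval t (A.semidirectBracket.eval s (g ∘ₗ LinearMap.fst k Q _) p) q r =
      A.semidirectBracket.eval s
          ((A.semidirectBracket.eval (s + t) (g ∘ₗ LinearMap.fst k Q _)).flip r) p q +
        A.semidirectBracket.eval s
          (A.semidirectBracket.eval t (g ∘ₗ LinearMap.fst k Q _) q) p r := by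
  have hleft (s : R) (p : Q × ConformalDual k Q) :
      A.semidirectBracket.eval s (g ∘ₗ LinearMap.fst k Q _) p =
        A.bracket.eval s g p.1 ∘ₗ LinearMap.fst k Q _ :=
    LinearMap.ext (A.semidirectBracket_eval_fst s g p)
  have hright : (A.semidirectBracket.eval (s + t) (g ∘ₗ LinearMap.fst k Q _)).flip r =
      (A.bracket.eval (s + t) g).flip r.1 ∘ₗ LinearMap.fst k Q _ :=
    LinearMap.ext fun p => A.semidirectBracket_eval_fst (s + t) g p r
  simp only [hleft, hright, semidirectBracket_eval_fst, A.eval_bracket_bracket s t]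

lemma semidirectBracket_leibniz_eval_snd (s t u : R) (v : Q) (p q r : Q × ConformalDual k Q) :
    A.semidirectBracket.eval t
        (A.semidirectBracket.eval s ((pairAt u).flip v ∘ₗ LinearMap.snd k Q _) p) q r =
      A.semidirectBracket.eval s ((A.semidirectBracket.eval (s + t)
          ((pairAt u).flip v ∘ₗ LinearMap.snd k Q _)).flip r) p q +
        A.semidirectBracket.eval s
          (A.semidirectBracket.eval t ((pairAt u).flip v ∘ₗ LinearMap.snd k Q _) q) p r := by
  obtain ⟨a, x⟩ := p
  obtain ⟨b, y⟩ := q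
  obtain ⟨c, z⟩ := r
  simp only [semidirectBracket_eq, dualSemidirect_eval_pairAt_left,
    dualSemidirect_eval_pairAt_right, map_sub, map_add, LinearMap.sub_apply,
    LinearMap.add_apply, LinearMap.add_comp, dualSemidirect_eval_fst,
    dualSemidirect_eval_polyPairAt, ← eval_apply]
  -- The terms in `z`, in `y` and in `x` cancel separately.
  have hz := A.eval_lhd_lhd s t (pairAt (u - t - s) z) a b v
  have hy₁ := A.eval_lhd_lhd s (u - t - s) (pairAt t y) a c v
  have hy₂ := A.eval_lhd_rhd s (-u) (pairAt t y) a v c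
  have hx₁ := A.eval_lhd_lhd t (u - t - s) (pairAt s x) b c v
  have hx₂ := A.eval_lhd_rhd t (-u) (pairAt s x) b v c
  have hx₃ := A.eval_rhd_rhd_add_eval_lhd_rhd (-u) (u - t - s) (pairAt s x) v c b
  rw [show s + (u - t - s) = u - t by ring] at hy₁
  rw [show s + -u = -(u - s) by ring] at hy₂
  rw [show t + (u - t - s) = u - s by ring] at hx₁
  rw [show t + -u = -(u - t) by ring] at hx₂
  rw [show -u + (u - t - s) = -(s + t) by ring] at hx₃
  rw [sub_right_comm u s t, show u - (s + t) = u - t - s by ring, add_sub_cancel_left]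
  simp only [bracket] at hz hy₁ hy₂ hx₁ hx₂ hx₃ ⊢
  linear_combination hy₁ + hy₂ - hz - hx₁ - hx₂ - hx₃

lemma isLeibniz_semidirectBracket : A.semidirectBracket.IsLeibniz := by
  let F : Module.Dual k Q ⊕ Q → (Q × ConformalDual k Q →ₗ[k] k[X]) :=
    Sum.elim (fun ψ => (Algebra.linearMap k k[X] ∘ₗ ψ) ∘ₗ LinearMap.fst k Q _)
      (fun v => (pair k).flip v ∘ₗ LinearMap.snd k Q _)
  have hF (p : Q × ConformalDual k Q) (hp : ∀ i, F i p = 0) : p = 0 := by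
    refine Prod.ext ?_ (ConformalDual.ext fun v => hp (.inr v))
    refine (Module.forall_dual_apply_eq_zero_iff k p.1).mp fun ψ => ?_
    simpa [F] using hp (.inl ψ)
  refine isLeibniz_of_eval hF _ fun i h hi s t p q r => ?_
  cases i with
  | inl ψ =>
    have hfst : h = (h ∘ₗ LinearMap.inl k Q _) ∘ₗ LinearMap.fst k Q _ :=
      LinearMap.ext fun q => by simp [hi, F]
    rw [hfst]
    exact A.semidirectBracket_leibniz_eval_fst s t _ p q r
  | inr v =>
    have hsnd : h = (pairAt (Polynomial.C (Polynomial.C Polynomial.X) : k[X][X][X])).flip v ∘ₗ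
        LinearMap.snd k Q _ := LinearMap.ext fun q => (hi q).trans (pairAt_C_C_X q.2 v).symm
    rw [hsnd]
    exact A.semidirectBracket_leibniz_eval_snd s t _ v p q r

end LDCA

end Leibniz

section TripleTensor

variable {k : Type*} [Field k] {R : Type*} [CommRing R] [Algebra k R]
  {L : Type*} [AddCommGroup L] [Module k L]

/-- The functional `a ⊗ b ⊗ c ↦ f(a) g(b) h(c)`. -/
def tripleFun (f g h : L →ₗ[k] R) : L ⊗[k] (L ⊗[k] L) →ₗ[k] R :=
  LinearMap.mul' k R ∘ₗ TensorProduct.map f (LinearMap.mul' k R ∘ₗ TensorProduct.map g h)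

@[simp] lemma tripleFun_tmul (f g h : L →ₗ[k] R) (x y z : L) :
    tripleFun f g h (x ⊗ₜ (y ⊗ₜ z)) = f x * (g y * h z) := rfl

variable [Module k[X] L] [IsScalarTower k k[X] L] {f g h : L →ₗ[k] R} {s : R}

lemma tripleFun_del₁ (hf : HasWeight f s) (T : L ⊗[k] (L ⊗[k] L)) :
    tripleFun f g h (del₁ k L T) = s * tripleFun f g h T := by
  refine LinearMap.congr_fun (f := tripleFun f g h ∘ₗ del₁ k L)
    (g := LinearMap.mulLeft k s ∘ₗ tripleFun f g h) ?_ T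
  ext x y z
  simp [del₁, hf x, mul_assoc]

lemma tripleFun_del₂ (hg : HasWeight g s) (T : L ⊗[k] (L ⊗[k] L)) :
    tripleFun f g h (del₂ k L T) = s * tripleFun f g h T := by
  refine LinearMap.congr_fun (f := tripleFun f g h ∘ₗ del₂ k L)
    (g := LinearMap.mulLeft k s ∘ₗ tripleFun f g h) ?_ T
  ext x y z
  simp [del₂, hg y, mul_left_comm, mul_assoc]

lemma tripleFun_ybTerm (br : ConformalBilin k L L L) {s₁ s₂ s₃ : R} (hs : s₁ + s₂ + s₃ = 0)
    (hf : HasWeight f s₁) (hg : HasWeight g s₂) (a b a' b' : L) :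
    tripleFun f g h (ybTerm br a b a' b') =
      br.eval s₂ f a a' * g b * h b' + f a * g a' * br.eval s₂ h b' b -
        f a * br.eval s₁ g b a' * h b' - f a * br.eval s₃ g a' b * h b' := by
  have h₁₂ (T : L ⊗[k] (L ⊗[k] L)) :
      tripleFun f g h ((-del₁ k L - del₂ k L) T) = s₃ * tripleFun f g h T := by
    rw [LinearMap.sub_apply, LinearMap.neg_apply, map_sub, map_neg, tripleFun_del₁ hf,
      tripleFun_del₂ hg]
    linear_combination (-tripleFun f g h T) * hs
  have hslot₁ : tripleFun f g h ∘ₗ slot₁ b b' = LinearMap.mulLeft k (g b * h b') ∘ₗ f :=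
    LinearMap.ext fun x => mul_comm _ _
  have hslot₂ : tripleFun f g h ∘ₗ slot₂ a b' = LinearMap.mulLeft k (f a * h b') ∘ₗ g :=
    LinearMap.ext fun x => by
      change f a * (g x * h b') = f a * h b' * g x
      ring
  have hslot₃ : tripleFun f g h ∘ₗ slot₃ a a' = LinearMap.mulLeft k (f a * g a') ∘ₗ h :=
    LinearMap.ext fun x => (mul_assoc _ _ _).symm
  rw [ybTerm, map_sub, map_sub, map_add, map_subst_eq_evalMap (tripleFun_del₂ hg),
    map_subst_eq_evalMap (tripleFun_del₂ hg), map_subst_eq_evalMap (tripleFun_del₁ hf),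
    map_subst_eq_evalMap h₁₂, hslot₁, hslot₂, hslot₃]
  simp only [evalMap_mulLeft_comp]
  simp only [← ConformalBilin.eval_apply]
  ring

end TripleTensor

section Separation

variable {k : Type*} [Field k] {L : Type*} [AddCommGroup L] [Module k L] [Module k[X] L]
  [IsScalarTower k k[X] L]

lemma aeval_sub_aeval_mem_range {V : Type*} [AddCommGroup V] [Module k V] {φ ψ : Module.End k V}
    (h : Commute φ ψ) (p : k[X]) (v : V) :
    Polynomial.aeval φ p v - Polynomial.aeval ψ p v ∈ LinearMap.range (φ - ψ) := by
  induction p using Polynomial.induction_on' with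
  | add p q hp hq =>
    simp only [map_add, LinearMap.add_apply, add_sub_add_comm]
    exact add_mem hp hq
  | monomial n c =>
    obtain ⟨χ, hχ⟩ := h.sub_dvd_pow_sub_pow n
    refine ⟨χ (c • v), ?_⟩
    rw [← Module.End.mul_apply, ← hχ]
    simp [Polynomial.aeval_monomial, smul_sub]

lemma aeval_del (p : k[X]) : Polynomial.aeval (del k L) p = Algebra.lsmul k k L p := by
  have h : del k L = Algebra.lsmul k k L Polynomial.X := rfl
  rw [h, Polynomial.aeval_algHom_apply, Polynomial.aeval_X_left_apply]

lemma aeval_del₁ (p : k[X]) (x y z : L) :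
    Polynomial.aeval (del₁ k L) p (x ⊗ₜ (y ⊗ₜ z)) = (p • x) ⊗ₜ (y ⊗ₜ z) := by
  have h : del₁ k L = Module.End.rTensorAlgHom k L (L ⊗[k] L) (del k L) := rfl
  rw [h, Polynomial.aeval_algHom_apply, aeval_del]
  rfl

lemma aeval_del₂ (p : k[X]) (x y z : L) :
    Polynomial.aeval (del₂ k L) p (x ⊗ₜ (y ⊗ₜ z)) = x ⊗ₜ ((p • y) ⊗ₜ z) := by
  have h : del₂ k L = (Module.End.lTensorAlgHom k (L ⊗[k] L) L).comp
    (Module.End.rTensorAlgHom k L L) (del k L) := rfl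
  rw [h, Polynomial.aeval_algHom_apply, aeval_del]
  rfl

lemma aeval_del₃ (p : k[X]) (x y z : L) :
    Polynomial.aeval (del₃ k L) p (x ⊗ₜ (y ⊗ₜ z)) = x ⊗ₜ (y ⊗ₜ (p • z)) := by
  have h : del₃ k L = (Module.End.lTensorAlgHom k (L ⊗[k] L) L).comp
    (Module.End.lTensorAlgHom k L L) (del k L) := rfl
  rw [h, Polynomial.aeval_algHom_apply, aeval_del]
  rfl

lemma commute_del₃_neg_sub : Commute (del₃ k L) (-del₁ k L - del₂ k L) :=
  have h₁ : Commute (del₃ k L) (del₁ k L) := TensorProduct.ext_threefold' fun _ _ _ => rfl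
  have h₂ : Commute (del₃ k L) (del₂ k L) := TensorProduct.ext_threefold' fun _ _ _ => rfl
  h₁.neg_right.sub_right h₂

lemma commute_aeval_del₁_aeval_del₂ (p q : k[X]) :
    Commute (Polynomial.aeval (del₁ k L) p) (Polynomial.aeval (del₂ k L) q) :=
  TensorProduct.ext_threefold' fun x y z => by
    simp only [Module.End.mul_apply, aeval_del₁, aeval_del₂]

variable (k L) in
/-- The action of `k[∂₁, ∂₂]`, encoded as `k[X] ⊗ k[X]`, on `L ⊗ L ⊗ L`. -/
def delAction : k[X] ⊗[k] k[X] →ₐ[k] Module.End k (L ⊗[k] (L ⊗[k] L)) :=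
  Algebra.TensorProduct.lift (Polynomial.aeval (del₁ k L)) (Polynomial.aeval (del₂ k L))
    commute_aeval_del₁_aeval_del₂

lemma delAction_X_tmul_one : delAction k L (Polynomial.X ⊗ₜ 1) = del₁ k L := by
  simp [delAction]

lemma delAction_one_tmul_X : delAction k L (1 ⊗ₜ Polynomial.X) = del₂ k L := by
  simp [delAction]

variable {κ : Type*} (E : Module.Basis κ k[X] L) {R : Type*} [CommRing R] [Algebra k R]

/-- The value at `∂ = s` of the `J`-th coordinate with respect to a `k[∂]`-basis. -/
def coordAt (J : κ) (s : R) : L →ₗ[k] R :=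
  (Polynomial.aeval s).toLinearMap ∘ₗ (E.coord J).restrictScalars k

lemma coordAt_apply (J : κ) (s : R) (x : L) :
    coordAt E J s x = Polynomial.aeval s (E.repr x J) := rfl

lemma hasWeight_coordAt (J : κ) (s : R) : HasWeight (coordAt E J s) s := fun x => by
  simp [coordAt_apply, del]

lemma coordAt_basis [DecidableEq κ] (I J : κ) (s : R) :
    coordAt E I s (E J) = if I = J then 1 else 0 := by
  simp [coordAt_apply, Finsupp.single_apply, eq_comm (a := I), apply_ite (Polynomial.aeval s)]

lemma delAction_coordAt (J : κ) (s : k[X] ⊗[k] k[X]) (x : L) :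
    delAction k L (coordAt E J s x) = Polynomial.aeval (delAction k L s) (E.repr x J) :=
  (Polynomial.aeval_algHom_apply (delAction k L) s (E.repr x J)).symm

lemma tmul_sub_sum_aeval_mem_range [Fintype κ] (x y z : L) :
    x ⊗ₜ (y ⊗ₜ z) - ∑ K, Polynomial.aeval (-del₁ k L - del₂ k L) (E.repr z K)
      (x ⊗ₜ (y ⊗ₜ E K)) ∈ LinearMap.range (del₁ k L + del₂ k L + del₃ k L) := by
  have hz : x ⊗ₜ[k] (y ⊗ₜ[k] z) =
      ∑ K, Polynomial.aeval (del₃ k L) (E.repr z K) (x ⊗ₜ (y ⊗ₜ E K)) := by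
    simp only [aeval_del₃, ← TensorProduct.tmul_sum, E.sum_repr]
  have hN : del₁ k L + del₂ k L + del₃ k L = del₃ k L - (-del₁ k L - del₂ k L) := by abel
  rw [hz, ← Finset.sum_sub_distrib, hN]
  exact Submodule.sum_mem _ fun K _ => aeval_sub_aeval_mem_range commute_del₃_neg_sub _ _

lemma sum_delAction_tripleFun_tmul [Fintype κ] {s₁ s₂ s₃ : k[X] ⊗[k] k[X]}
    (h₁ : delAction k L s₁ = del₁ k L) (h₂ : delAction k L s₂ = del₂ k L) (x y z : L) :
    ∑ K, ∑ J, ∑ I, delAction k L (tripleFun (coordAt E I s₁) (coordAt E J s₂) (coordAt E K s₃)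
        (x ⊗ₜ (y ⊗ₜ z))) (E I ⊗ₜ (E J ⊗ₜ E K)) =
      ∑ K, Polynomial.aeval (delAction k L s₃) (E.repr z K) (x ⊗ₜ (y ⊗ₜ E K)) := by
  refine Finset.sum_congr rfl fun K _ => ?_
  have hxy : x ⊗ₜ[k] (y ⊗ₜ[k] E K) =
      ∑ J, ∑ I, (E.repr x I • E I) ⊗ₜ ((E.repr y J • E J) ⊗ₜ E K) := by
    simp only [← TensorProduct.sum_tmul, ← TensorProduct.tmul_sum, E.sum_repr]
  simp only [hxy, map_sum]
  refine Finset.sum_congr rfl fun J _ => Finset.sum_congr rfl fun I _ => ?_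
  rw [tripleFun_tmul, ← mul_assoc, mul_comm, map_mul, map_mul, delAction_coordAt,
    delAction_coordAt, delAction_coordAt, h₁, h₂, Module.End.mul_apply, Module.End.mul_apply,
    aeval_del₂, aeval_del₁]

/-- Modulo the image `∂₃` acts as `-∂₁ - ∂₂`, so `T` is rebuilt from its coordinates at the generic
point `(X₁, X₂, -X₁ - X₂)` of the plane `s₁ + s₂ + s₃ = 0`. -/
lemma mem_range_del_of_tripleFun [Finite κ] (T : L ⊗[k] (L ⊗[k] L))
    (hT : ∀ (I J K : κ) (s₁ s₂ s₃ : k[X] ⊗[k] k[X]), s₁ + s₂ + s₃ = 0 →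
      tripleFun (coordAt E I s₁) (coordAt E J s₂) (coordAt E K s₃) T = 0) :
    T ∈ LinearMap.range (del₁ k L + del₂ k L + del₃ k L) := by
  have := Fintype.ofFinite κ
  set N := LinearMap.range (del₁ k L + del₂ k L + del₃ k L)
  let s₁ : k[X] ⊗[k] k[X] := Polynomial.X ⊗ₜ 1
  let s₂ : k[X] ⊗[k] k[X] := 1 ⊗ₜ Polynomial.X
  have h₃ : delAction k L (-s₁ - s₂) = -del₁ k L - del₂ k L := by
    rw [map_sub, map_neg, delAction_X_tmul_one, delAction_one_tmul_X]
  let rebuild : L ⊗[k] (L ⊗[k] L) →ₗ[k] L ⊗[k] (L ⊗[k] L) :=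
    ∑ K, ∑ J, ∑ I, LinearMap.applyₗ (E I ⊗ₜ (E J ⊗ₜ E K)) ∘ₗ (delAction k L).toLinearMap ∘ₗ
      tripleFun (coordAt E I s₁) (coordAt E J s₂) (coordAt E K (-s₁ - s₂))
  have rebuild_apply (T : L ⊗[k] (L ⊗[k] L)) : rebuild T = ∑ K, ∑ J, ∑ I,
      delAction k L (tripleFun (coordAt E I s₁) (coordAt E J s₂) (coordAt E K (-s₁ - s₂)) T)
        (E I ⊗ₜ (E J ⊗ₜ E K)) := by
    simp [rebuild]
  have hrebuild : N.mkQ = N.mkQ ∘ₗ rebuild := TensorProduct.ext_threefold' fun x y z => by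
    refine (Submodule.Quotient.eq N).mpr ?_
    rw [rebuild_apply, sum_delAction_tripleFun_tmul E delAction_X_tmul_one delAction_one_tmul_X,
      h₃]
    exact tmul_sub_sum_aeval_mem_range E x y z
  have hT₀ : rebuild T = 0 := by simp [rebuild_apply, hT]
  rw [← Submodule.Quotient.mk_eq_zero, ← Submodule.mkQ_apply, hrebuild, LinearMap.comp_apply, hT₀,
    map_zero]

end Separation

section BasisTensor

variable {k : Type*} [Field k] {R : Type*} [CommRing R] [Algebra k R] {L : Type*} [AddCommGroup L]
  [Module k L] [Module k[X] L] [IsScalarTower k k[X] L] {κ : Type*} [Fintype κ]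

lemma tripleFun_ybBilin (E : Module.Basis κ k[X] L) {σ : κ → κ} (hσ : Function.Involutive σ)
    (br : ConformalBilin k L L L) {s₁ s₂ s₃ : R} (hs : s₁ + s₂ + s₃ = 0) (I J K : κ) :
    tripleFun (coordAt E I s₁) (coordAt E J s₂) (coordAt E K s₃)
      (ybBilin br (∑ J, E J ⊗ₜ[k] E (σ J)) (∑ J, E J ⊗ₜ[k] E (σ J))) =
    br.eval s₂ (coordAt E I s₁) (E (σ J)) (E (σ K)) +
      br.eval s₂ (coordAt E K s₃) (E (σ J)) (E (σ I)) -
      br.eval s₁ (coordAt E J s₂) (E (σ I)) (E (σ K)) -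
      br.eval s₃ (coordAt E J s₂) (E (σ K)) (E (σ I)) := by
  classical
  have hσ' (A B : κ) : A = σ B ↔ σ A = B := hσ.eq_iff.symm
  simp only [map_sum, LinearMap.sum_apply, ybBilin_tmul,
    tripleFun_ybTerm br hs (hasWeight_coordAt E I s₁) (hasWeight_coordAt E J s₂), coordAt_basis,
    hσ', Finset.sum_add_distrib, Finset.sum_sub_distrib, mul_ite, ite_mul, mul_one, mul_zero,
    one_mul, zero_mul, Finset.sum_ite_irrel, Finset.sum_ite_eq, Finset.mem_univ, if_true,
    Finset.sum_const_zero]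

end BasisTensor

section CanonicalTensor

variable {k : Type*} [Field k] {R : Type*} [CommRing R] [Algebra k R]
  {Q : Type*} [AddCommGroup Q] [Module k Q] [Module k[X] Q] [IsScalarTower k k[X] Q]

/-- The symmetric form `⟨y, a⟩_s + ⟨x, b⟩_{-s}` of `a + x` and `b + y` in `Q ⊕ Q^{*c}`, as a
functional of `a + x`. -/
def dualForm (s : R) (v : Q × ConformalDual k Q) : Q × ConformalDual k Q →ₗ[k] R :=
  pairAt s v.2 ∘ₗ LinearMap.fst k Q _ + (pairAt (-s)).flip v.1 ∘ₗ LinearMap.snd k Q _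

lemma dualForm_dualSemidirect_invariant [Module.Finite k[X] Q] (lhd rhd : ConformalBilin k Q Q Q)
    {s₁ s₂ s₃ : R} (hs : s₁ + s₂ + s₃ = 0) (u v w : Q × ConformalDual k Q) :
    (dualSemidirect lhd rhd).eval s₂ (dualForm s₁ u) v w +
        (dualSemidirect lhd rhd).eval s₂ (dualForm s₃ w) v u -
        (dualSemidirect lhd rhd).eval s₁ (dualForm s₂ v) u w -
        (dualSemidirect lhd rhd).eval s₃ (dualForm s₂ v) w u = 0 := by
  have h₁₂ : -s₁ - s₂ = s₃ := by linear_combination -hs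
  have h₃₂ : -s₃ - s₂ = s₁ := by linear_combination -hs
  have h₂₁ : -s₂ - s₁ = s₃ := by linear_combination -hs
  have h₂₃ : -s₂ - s₃ = s₁ := by linear_combination -hs
  simp only [dualForm, map_add, LinearMap.add_apply, dualSemidirect_eval_fst,
    dualSemidirect_eval_pairAt, ConformalBilin.add_eval, h₁₂, h₃₂, h₂₁, h₂₃, neg_neg]
  ring

variable {ι : Type*} [Fintype ι] (b : Module.Basis ι k[X] Q)

lemma repr_eq_pair_dualBasis (i : ι) (a : Q) : b.repr a i = pair k (dualBasis b i) a := by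
  classical
  conv_rhs => rw [← b.sum_repr a, map_sum]
  simp [apply_poly_smul _ (pair_del k (dualBasis b i)), pair_dualBasis]

lemma dualBasis_repr (i : ι) (x : ConformalDual k Q) :
    (dualBasis b).repr x i = (pair k x (b i)).comp (-Polynomial.X) := rfl

lemma coordAt_prod_dualBasis (J : ι ⊕ ι) (s : R) :
    coordAt (b.prod (dualBasis b)) J s = dualForm s (b.prod (dualBasis b) J.swap) := by
  refine LinearMap.ext fun w => ?_
  cases J with
  | inl i =>
    rw [coordAt_apply, Module.Basis.prod_repr_inl, repr_eq_pair_dualBasis]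
    simp [dualForm, Module.Basis.prod_apply, pairAt_apply]
  | inr i =>
    rw [coordAt_apply, Module.Basis.prod_repr_inr, dualBasis_repr, Polynomial.aeval_comp]
    simp [dualForm, Module.Basis.prod_apply, pairAt_apply]

lemma canonicalTensor_eq_sum : canonicalTensor b =
    ∑ J : ι ⊕ ι, b.prod (dualBasis b) J ⊗ₜ[k] b.prod (dualBasis b) J.swap := by
  rw [Fintype.sum_sum_type, canonicalTensor, Finset.sum_add_distrib, add_comm]
  simp [Module.Basis.prod_apply]

lemma comm_canonicalTensor :
    TensorProduct.comm k _ _ (canonicalTensor b) = canonicalTensor b := by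
  simp [canonicalTensor, map_sum, add_comm]

lemma isCLCYBESolution_canonicalTensor [Module.Finite k[X] Q] (lhd rhd : ConformalBilin k Q Q Q) :
    IsCLCYBESolution (dualSemidirect lhd rhd) (canonicalTensor b) :=
  mem_range_del_of_tripleFun (b.prod (dualBasis b)) _ fun I J K s₁ s₂ s₃ hs => by
    rw [canonicalTensor_eq_sum, tripleFun_ybBilin _ Sum.swap_swap _ hs]
    simp only [coordAt_prod_dualBasis]
    exact dualForm_dualSemidirect_invariant lhd rhd hs _ _ _

end CanonicalTensor

end LeibnizConformal

end

theorem theorem4p16_general {k : Type*} [Field k] {Q : Type*} [AddCommGroup Q] [Module k Q]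
    [Module (Polynomial k) Q] [IsScalarTower k (Polynomial k) Q] [Module.Finite (Polynomial k) Q]
    (A : LeibnizConformal.LDCA k Q)
    {ι : Type*} [Fintype ι] (b : Module.Basis ι (Polynomial k) Q) :
    A.semidirectBracket.IsLeibniz ∧
      LeibnizConformal.IsCLCYBESolution A.semidirectBracket
        (LeibnizConformal.canonicalTensor b) ∧
      TensorProduct.comm k _ _ (LeibnizConformal.canonicalTensor b) =
        LeibnizConformal.canonicalTensor b :=
  ⟨A.isLeibniz_semidirectBracket,
    LeibnizConformal.isCLCYBESolution_canonicalTensor b A.lhd A.rhd,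
    LeibnizConformal.comm_canonicalTensor b⟩

theorem theorem4p16 {k : Type*} [Field k] [CharZero k] {Q : Type*} [AddCommGroup Q] [Module k Q]
    [Module (Polynomial k) Q] [IsScalarTower k (Polynomial k) Q] [Module.Finite (Polynomial k) Q]
    (A : LeibnizConformal.LDCA k Q)
    {ι : Type*} [Fintype ι] (b : Module.Basis ι (Polynomial k) Q) :
    A.semidirectBracket.IsLeibniz ∧
      LeibnizConformal.IsCLCYBESolution A.semidirectBracket
        (LeibnizConformal.canonicalTensor b) ∧
      TensorProduct.comm k _ _ (LeibnizConformal.canonicalTensor b) =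
        LeibnizConformal.canonicalTensor b :=
  theorem4p16_general A b
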